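/- **Theorem 1.1 (parts (i) and (ii)).** Let $X$ be a $1$-reduced simplicial set (exactly one $0$-simplex and exactly one $1$-simplex), $G$ a simplicial group and $\tau\colon X_{>0}\to G$ a twisting function, that is, a map of degree $-1$ with $d_0\tau(x)=\tau(d_0x)^{-1}\tau(d_1x)$, $d_k\tau(x)=\tau(d_{k+1}x)$ for $k\ge1$, $s_k\tau(x)=\tau(s_{k+1}x)$ and $\tau(s_0x)=1$. *Notation.* For $x\in X_{n+1}$ and $\boldsymbol i=(i_1,\dots,i_n)$ with $0\le i_k\le n-k$, the Szczarba operator is $$\mathrm{Sz}_{\boldsymbol i}\,x=D_{\boldsymbol i,0}\,\tau(x)^{-1}\cdot D_{\boldsymbol i,1}\,\tau(d_0x)^{-1}\cdots D_{\boldsymbol i,n}\,\tau((d_0)^nx)^{-1}\in G_n ,$$ where $D_{\varnothing,0}=\mathrm{id}$ and, with $\boldsymbol i'=(i_2,\dots,i_n)$ and $D'$ the derived operator of $D$, $D_{\boldsymbol i,k}$ equals $D_{\boldsymbol i',k}'\,s_0\,d_{i_1-k}$ if $k<i_1$, $D_{\boldsymbol i',k}'$ if $k=i_1$, and $D_{\boldsymbol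 i',k-1}'\,s_0$ if $k>i_1$. For $\pi\in S_n$ put $\mathrm{Sz}_\pi=\mathrm{Sz}_{\boldsymbol i}$ with $i_k=\pi(k)-\#\{j\le k\mid\pi(j)\le\pi(k)\}$. The cubical cobar construction $\hat\Omega X$ is the cubical monoid (cubical set with connections) generated by $n$-cubes $\langle x\rangle$ for $x\in X_{n+1}$, $n\ge0$, subject to $d^1_i\langle x\rangle=\langle d_ix\rangle$ and $d^0_i\langle x\rangle=\langle x(0\dots i)\rangle\langle x(i\dots n+1)\rangle$ for $1\le i\le n$; $\gamma_i\langle x\rangle=\langle s_ix\rangle$ for the connections (induced by taking the minimum of the coordinates $i$ and $i+1$), $1\le i\le n$; $s_1\langle x\rangle=\langle s_0x\rangle$ and $s_{n+1}\langle x\rangle=\langle s_{n+1}x\rangle$ for the extreme degeneracies; and $\langle x\rangle=1$ for $x\in X_1$. Products of cubes are written $\langle x_1,\dots,x_k\rangle$. Its triangulation $T\hat\Omega X$ is the simplicial monoid obtained by replacing each cube $y$ of dimension $n$ by a simplicial cube $(\Delta^1)^n$; it consists of classes $[y,u]$ with $u$ a simplex of $(\Delta^1)^n$. For $\pi\in S_n$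 let $u_\pi$ be the $n$-simplex of $(\Delta^1)^n$ whose $t$-th vertex has the coordinates $\pi(1),\dots,\pi(t)$ equal to $1$ and the others equal to $0$, $0\le t\le n$. Let $R$ be a commutative ring. $C(-)$ denotes normalized chains with coefficients in $R$; for cubical sets one divides by degenerate and folded cubes. $t\colon C(Y)\to C(TY)$ is $y\mapsto\sum_{\pi\in S_n}(-1)^{\pi}[y,u_\pi]$ for an $n$-cube $y$. $\Omega C(X)$ is the reduced cobar construction, whose underlying algebra is the tensor algebra of the desuspended reduced chains, and $\Omega C(X)\to C(\hat\Omega X)$ is the canonical isomorphism $\langle x_1|\dots|x_k\rangle\mapsto\langle x_1,\dots,x_k\rangle$ for $x_1,\dots,x_k$ of dimension at least $2$ (the reduced chains vanish in degree $1$). The Szczarba map is $f_{\mathrm{Sz}}\colon\Omega C(X)\to C(G)$, $\langle x_1|\dots|x_k\rangle\mapsto t_{\mathrm{Sz}}(x_1)\cdots t_{\mathrm{Sz}}(x_k)$, the product being the shuffle map followed by the multiplication of $G$, where $t_{\mathrm{Sz}}(x)=\mathrm{Sz}_\varnothing x-1$ for $x\in X_1$ and $t_{\mathrm{Sz}}(x)=\sum_{\boldsymbol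 i}(-1)^{i_1+\dots+i_n}\,\mathrm{Sz}_{\boldsymbol i}\,x$ for $x\in X_{n+1}$, $n\ge1$. *Claim.* (i) There is a unique morphism of simplicial monoids $f\colon T\hat\Omega X\to G$ with $f([\langle x\rangle,u_\pi])=\mathrm{Sz}_\pi\,x$ for all $n\ge0$, $x\in X_{n+1}$ and $\pi\in S_n$. (ii) For every commutative ring $R$, the composition $\Omega C(X)\cong C(\hat\Omega X)\xrightarrow{\;t\;}C(T\hat\Omega X)\xrightarrow{\;C(f)\;}C(G)$ is the Szczarba map $f_{\mathrm{Sz}}$. -/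

import Mathlib

open CategoryTheory Opposite

universe u v

namespace SzCobar

/-- The `n`-simplices of a simplicial set. -/
abbrev Simp (X : SSet.{u}) (n : ℕ) : Type u := X.obj (op (SimplexCategory.mk n))

/-! ### The cube category -/

/-- The vertex set of the `n`-cube, with its componentwise partial order. -/
abbrev Vert (n : ℕ) : Type := Fin n → Bool

/-- The coface map inserting the constant `ε` as coordinate `i`. -/
def cofaceFun {n : ℕ} (ε : Bool) (i : Fin (n + 1)) (t : Vert n) : Vert (n + 1) :=
  i.insertNth ε t

/-- The codegeneracy map dropping coordinate `i`. -/
def codegenFun {n : ℕ} (i : Fin (n + 1)) (t : Vert (n + 1)) : Vert n :=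
  fun c => t (i.succAbove c)

/-- The coconnection map replacing the coordinates `i` and `i + 1` by their minimum. -/
def coconnFun {n : ℕ} (i : Fin (n + 1)) (t : Vert (n + 2)) : Vert (n + 1) :=
  fun c => if c < i then t c.castSucc else if c = i then min (t c.castSucc) (t c.succ) else t c.succ

/-- The Cartesian product of two maps between cubes. -/
def prodFun {m n m' n' : ℕ} (f : Vert m → Vert n) (g : Vert m' → Vert n')
    (t : Vert (m + m')) : Vert (n + n') :=
  Fin.append (f fun c => t (Fin.castAdd m' c)) (g fun c => t (Fin.natAdd m c))

/-- The morphisms of the cube category with connections: the maps generated by the cofaces, the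
codegeneracies and the coconnections under composition and Cartesian product. -/
inductive IsCubeMap : {m n : ℕ} → (Vert m → Vert n) → Prop
  | id (n : ℕ) : IsCubeMap (fun t : Vert n => t)
  | comp {m n p : ℕ} {f : Vert m → Vert n} {g : Vert n → Vert p} :
      IsCubeMap f → IsCubeMap g → IsCubeMap (fun t => g (f t))
  | prod {m n m' n' : ℕ} {f : Vert m → Vert n} {g : Vert m' → Vert n'} :
      IsCubeMap f → IsCubeMap g → IsCubeMap (prodFun f g)
  | coface {n : ℕ} (ε : Bool) (i : Fin (n + 1)) : IsCubeMap (cofaceFun ε i)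
  | codegen {n : ℕ} (i : Fin (n + 1)) : IsCubeMap (codegenFun i)
  | coconn {n : ℕ} (i : Fin (n + 1)) : IsCubeMap (coconnFun i)

theorem IsCubeMap.monotone {m n : ℕ} {f : Vert m → Vert n} (hf : IsCubeMap f) : Monotone f := by
  induction hf with
  | id n => exact fun _ _ h => h
  | comp _ _ h₁ h₂ => exact fun _ _ h => h₂ (h₁ h)
  | prod _ _ h₁ h₂ =>
    intro a b h c
    refine Fin.addCases (fun c => ?_) (fun c => ?_) c
    · simpa only [prodFun, Fin.append_left] using h₁ (fun _ => h _) c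
    · simpa only [prodFun, Fin.append_right] using h₂ (fun _ => h _) c
  | coface ε i =>
    intro a b h c
    rcases Fin.eq_self_or_eq_succAbove i c with rfl | ⟨j, rfl⟩
    · simp [cofaceFun]
    · simpa [cofaceFun] using h j
  | codegen i => exact fun a b h c => h _
  | coconn i =>
    intro a b h c
    simp only [coconnFun]
    split_ifs
    · exact h _
    · exact min_le_min (h _) (h _)
    · exact h _

/-- Morphisms of the cube category. -/
@[ext]
structure CubeMap (m n : ℕ) where
  toFun : Vert m → Vert n
  isCubeMap : IsCubeMap toFun

namespace CubeMap

def id (n : ℕ) : CubeMap n n := ⟨fun t => t, .id n⟩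

/-- `g.comp f` is the map `g ∘ f`. -/
def comp {m n p : ℕ} (g : CubeMap n p) (f : CubeMap m n) : CubeMap m p :=
  ⟨fun t => g.toFun (f.toFun t), .comp f.isCubeMap g.isCubeMap⟩

def prod {m n m' n' : ℕ} (f : CubeMap m n) (g : CubeMap m' n') : CubeMap (m + m') (n + n') :=
  ⟨prodFun f.toFun g.toFun, .prod f.isCubeMap g.isCubeMap⟩

def coface {n : ℕ} (ε : Bool) (i : Fin (n + 1)) : CubeMap n (n + 1) := ⟨_, .coface ε i⟩

def codegen {n : ℕ} (i : Fin (n + 1)) : CubeMap (n + 1) n := ⟨_, .codegen i⟩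

def coconn {n : ℕ} (i : Fin (n + 1)) : CubeMap (n + 2) (n + 1) := ⟨_, .coconn i⟩

/-- The identity map, for two propositionally equal dimensions. -/
def cast {m n : ℕ} (h : m = n) : CubeMap m n :=
  ⟨fun t c => t (c.cast h.symm), by subst h; exact .id m⟩

theorem prod_id_id (m n : ℕ) : (id m).prod (id n) = id (m + n) := by
  ext t c
  refine Fin.addCases (fun c => ?_) (fun c => ?_) c <;> simp [prod, prodFun, id]

theorem prod_comp_prod {m n p m' n' p' : ℕ} (g : CubeMap n p) (f : CubeMap m n)
    (g' : CubeMap n' p') (f' : CubeMap m' n') :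
    (g.comp f).prod (g'.comp f') = (g.prod g').comp (f.prod f') := by
  ext t c
  simp [prod, prodFun, comp]

end CubeMap

/-! ### Cubical sets and cubical monoids -/

/-- A cubical set (with connections): a presheaf on the cube category. -/
structure CubicalSet where
  cube : ℕ → Type u
  map {m n : ℕ} : CubeMap m n → cube n → cube m
  map_id {n : ℕ} (y : cube n) : map (CubeMap.id n) y = y
  map_comp {m n p : ℕ} (g : CubeMap n p) (f : CubeMap m n) (y : cube p) :
    map (g.comp f) y = map f (map g y)

/-- A monoid for the product of cubical sets: the product of a `k`-cube and an `l`-cube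
is a `(k + l)`-cube, and structure maps are applied componentwise. -/
structure CubicalMonoid extends CubicalSet.{u} where
  one : cube 0
  mul {k l : ℕ} : cube k → cube l → cube (k + l)
  map_mul {m n m' n' : ℕ} (f : CubeMap m n) (g : CubeMap m' n') (y : cube n) (z : cube n') :
    mul (map f y) (map g z) = map (f.prod g) (mul y z)
  one_mul {n : ℕ} (y : cube n) : mul one y = map (CubeMap.cast (Nat.zero_add n)) y
  mul_one {n : ℕ} (y : cube n) : mul y one = y
  mul_assoc {k l m : ℕ} (x : cube k) (y : cube l) (z : cube m) :
    mul (mul x y) z = map (CubeMap.cast (Nat.add_assoc k l m)) (mul x (mul y z))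

/-! ### Simplicial cubes and triangulations -/

/-- The `m`-simplices of the simplicial `n`-cube: weakly increasing sequences of `m + 1` vertices. -/
abbrev CubeSimplex (n m : ℕ) : Type := Fin (m + 1) →o Vert n

namespace CubeSimplex

/-- The map of simplicial cubes induced by a map of the cube category. -/
def push {m n d : ℕ} (f : CubeMap m n) (u : CubeSimplex m d) : CubeSimplex n d :=
  ⟨fun t => f.toFun (u t), fun _ _ h => f.isCubeMap.monotone (u.monotone h)⟩

/-- A pair of simplices, viewed in the product cube. -/
def pair {k l d : ℕ} (v : CubeSimplex k d) (w : CubeSimplex l d) : CubeSimplex (k + l) d :=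
  ⟨fun t => Fin.append (v t) (w t), fun a b h c => by
    refine Fin.addCases (fun c => ?_) (fun c => ?_) c
    · simpa only [Fin.append_left] using v.monotone h c
    · simpa only [Fin.append_right] using w.monotone h c⟩

/-- The top-dimensional simplex of the `n`-cube given by the permutation `π`: at vertex `t`
exactly the coordinates `π 0, …, π (t - 1)` have the value `1`. -/
def ofPerm {n : ℕ} (π : Equiv.Perm (Fin n)) : CubeSimplex n n :=
  ⟨fun t c => decide ((π.symm c : ℕ) < t), fun a b h c => by
    simp only [Bool.le_iff_imp, decide_eq_true_eq]
    exact fun h' => lt_of_lt_of_le h' h⟩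

theorem push_apply {m n d : ℕ} (f : CubeMap m n) (u : CubeSimplex m d) (t : Fin (d + 1)) :
    push f u t = f.toFun (u t) := rfl

theorem pair_apply {k l d : ℕ} (v : CubeSimplex k d) (w : CubeSimplex l d) (t : Fin (d + 1)) :
    pair v w t = Fin.append (v t) (w t) := rfl

theorem push_pair {m n m' n' d : ℕ} (f : CubeMap m n) (g : CubeMap m' n')
    (v : CubeSimplex m d) (w : CubeSimplex m' d) :
    push (f.prod g) (pair v w) = pair (push f v) (push g w) := by
  ext t c
  simp [push_apply, pair_apply, CubeMap.prod, prodFun]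

end CubeSimplex

open CubeSimplex

/-- The identifications `(f^* y, u) ∼ (y, f_* u)` defining the triangulation. -/
inductive TriangRel (Y : CubicalSet.{u}) (d : ℕ) :
    (Σ n, Y.cube n × CubeSimplex n d) → (Σ n, Y.cube n × CubeSimplex n d) → Prop
  | mk {m n : ℕ} (f : CubeMap m n) (y : Y.cube n) (u : CubeSimplex m d) :
      TriangRel Y d ⟨m, Y.map f y, u⟩ ⟨n, y, push f u⟩

/-- The `d`-simplices of the triangulation of a cubical set. -/
def Triang (Y : CubicalSet.{u}) (d : ℕ) : Type u := Quot (TriangRel Y d)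

namespace Triang

variable {Y : CubicalSet.{u}}

/-- The simplex `[y, u]`. -/
def mk {n d : ℕ} (y : Y.cube n) (u : CubeSimplex n d) : Triang Y d := Quot.mk _ ⟨n, y, u⟩

theorem mk_map {m n d : ℕ} (f : CubeMap m n) (y : Y.cube n) (u : CubeSimplex m d) :
    mk (Y.map f y) u = mk y (push f u) := Quot.sound (.mk f y u)

/-- Simplicial operators act on the second component of `[y, u]`. -/
def map {d e : ℕ} (f : Fin (e + 1) →o Fin (d + 1)) : Triang Y d → Triang Y e :=
  Quot.map (fun s => ⟨s.1, s.2.1, s.2.2.comp f⟩) (by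
    rintro _ _ ⟨g, y, u⟩
    exact TriangRel.mk g y (u.comp f))

end Triang

/-- The triangulation of a cubical set. -/
def triang (Y : CubicalSet.{u}) : SSet.{u} where
  obj Δ := Triang Y Δ.unop.len
  map f := ↾(Triang.map f.unop.toOrderHom)
  map_id Δ := by
    ext s
    induction s using Quot.ind
    rfl
  map_comp f g := by
    ext s
    induction s using Quot.ind
    rfl

section TriangMonoid

variable (Y : CubicalMonoid.{u})

/-- The product `[y, v] [z, w] = [y z, (v, w)]`. -/
instance (d : ℕ) : Mul (Triang Y.toCubicalSet d) where
  mul := Quot.map₂ (fun s s' => ⟨s.1 + s'.1, Y.mul s.2.1 s'.2.1, pair s.2.2 s'.2.2⟩)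
    (by
      rintro ⟨k, y, v⟩ _ _ ⟨g, z, w⟩
      have h := TriangRel.mk (Y := Y.toCubicalSet) ((CubeMap.id k).prod g) (Y.mul y z) (pair v w)
      rw [← Y.map_mul, Y.map_id, push_pair] at h
      exact h)
    (by
      rintro _ _ ⟨l, z, w⟩ ⟨f, y, v⟩
      have h := TriangRel.mk (Y := Y.toCubicalSet) (f.prod (CubeMap.id l)) (Y.mul y z) (pair v w)
      rw [← Y.map_mul, Y.map_id, push_pair] at h
      exact h)

instance (d : ℕ) : One (Triang Y.toCubicalSet d) where
  one := Triang.mk Y.one ⟨fun _ => Fin.elim0, fun _ _ _ c => c.elim0⟩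

theorem Triang.mk_mul_mk {k l d : ℕ} (y : Y.cube k) (z : Y.cube l) (v : CubeSimplex k d)
    (w : CubeSimplex l d) :
    (Triang.mk y v * Triang.mk z w : Triang Y.toCubicalSet d) =
      Triang.mk (Y.mul y z) (pair v w) := rfl

theorem Triang.one_def (d : ℕ) : (1 : Triang Y.toCubicalSet d) =
    Triang.mk Y.one ⟨fun _ => Fin.elim0, fun _ _ _ c => c.elim0⟩ := rfl

instance (d : ℕ) : Monoid (Triang Y.toCubicalSet d) where
  mul_assoc a b c := by
    induction a using Quot.ind with | _ a
    induction b using Quot.ind with | _ b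
    induction c using Quot.ind with | _ c
    obtain ⟨k, x, u⟩ := a
    obtain ⟨l, y, v⟩ := b
    obtain ⟨m, z, w⟩ := c
    change Triang.mk (Y.mul (Y.mul x y) z) (pair (pair u v) w) =
      Triang.mk (Y.mul x (Y.mul y z)) (pair u (pair v w))
    rw [Y.mul_assoc, Triang.mk_map]
    congr 1
    ext t c
    simp [push_apply, pair_apply, CubeMap.cast, Fin.append_assoc]
  one_mul a := by
    induction a using Quot.ind with | _ a
    obtain ⟨k, x, u⟩ := a
    change Triang.mk (Y.mul Y.one x) (pair _ u) = Triang.mk x u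
    rw [Y.one_mul, Triang.mk_map]
    congr 1
    ext t c
    rw [push_apply, pair_apply]
    simp only [CubeMap.cast]
    exact congrFun (Fin.elim0_append _) (Fin.cast _ c)
  mul_one a := by
    induction a using Quot.ind with | _ a
    obtain ⟨k, x, u⟩ := a
    change Triang.mk (Y.mul x Y.one) (pair u _) = Triang.mk x u
    rw [Y.mul_one]
    congr 1
    ext t c
    rw [pair_apply]
    exact congrFun (Fin.append_elim0 _) c

theorem Triang.map_mul {d e : ℕ} (f : Fin (e + 1) →o Fin (d + 1))
    (a b : Triang Y.toCubicalSet d) :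
    Triang.map f (a * b) = Triang.map f a * Triang.map f b := by
  induction a using Quot.ind
  induction b using Quot.ind
  rfl

/-- The triangulation of a cubical monoid, as a simplicial monoid. -/
def triangMonoid : SimplicialObject MonCat.{u} where
  obj Δ := MonCat.of (Triang Y.toCubicalSet Δ.unop.len)
  map f := MonCat.ofHom
    { toFun := Triang.map f.unop.toOrderHom
      map_one' := rfl
      map_mul' := Triang.map_mul Y _ }
  map_id Δ := by
    ext s
    induction s using Quot.ind
    rfl
  map_comp f g := by
    ext s
    induction s using Quot.ind
    rfl

end TriangMonoid

/-! ### The cubical cobar construction -/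

/-- A simplicial set is `1`-reduced if it has exactly one `0`-simplex and exactly one `1`-simplex. -/
structure IsOneReduced (X : SSet.{u}) : Prop where
  nonempty_zero : Nonempty (Simp X 0)
  subsingleton_zero : Subsingleton (Simp X 0)
  subsingleton_one : Subsingleton (Simp X 1)

/-- The face of `x` spanned by the vertices `a, …, a + l`. -/
def interval (X : SSet.{u}) {n : ℕ} (a l : ℕ) (h : a + l ≤ n) (x : Simp X n) : Simp X l :=
  X.map (SimplexCategory.subinterval a l h).op x

/-- Strings `x₁, …, x_k` of simplices of positive dimension. -/
abbrev Word (X : SSet.{u}) : Type u := List (Σ n : ℕ, Simp X (n + 1))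

namespace Word

variable {X : SSet.{u}}

/-- The dimension of the cube `⟨x₁, …, x_k⟩`; an `(n + 1)`-simplex contributes `n`. -/
def dim : Word X → ℕ
  | [] => 0
  | x :: w => x.1 + dim w

theorem dim_append (w w' : Word X) : dim (w ++ w') = dim w + dim w' := by
  induction w with
  | nil => simp [dim]
  | cons x w ih => simp only [List.cons_append, dim, ih, Nat.add_assoc]

/-- The product of two maps of cubes, with respect to the concatenation of words. -/
def prodMap {w₁ w₁' w₂ w₂' : Word X} (f₁ : CubeMap w₁'.dim w₁.dim) (f₂ : CubeMap w₂'.dim w₂.dim) :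
    CubeMap (w₁' ++ w₂').dim (w₁ ++ w₂).dim :=
  ((CubeMap.cast (dim_append w₁ w₂).symm).comp (f₁.prod f₂)).comp
    (CubeMap.cast (dim_append w₁' w₂'))

theorem prodMap_comp {m n : ℕ} {w₁ w₁' w₂ w₂' : Word X} (f₁ : CubeMap w₁'.dim w₁.dim)
    (f₂ : CubeMap w₂'.dim w₂.dim) (g₁ : CubeMap m w₁'.dim) (g₂ : CubeMap n w₂'.dim) :
    (prodMap f₁ f₂).comp ((CubeMap.cast (dim_append w₁' w₂').symm).comp (g₁.prod g₂)) =
      (CubeMap.cast (dim_append w₁ w₂).symm).comp ((f₁.comp g₁).prod (f₂.comp g₂)) := by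
  rw [CubeMap.prod_comp_prod]
  rfl

end Word

/-- `WordMap w' w f` says that the identity `f^* ⟨w⟩ = ⟨w'⟩` is imposed in the cubical cobar
construction: these are the formulas for the faces, connections and extreme degeneracies of a
cube `⟨x⟩` together with `⟨x⟩ = 1` for `x` of dimension `1`, applied to the letters of `w`. -/
inductive WordMap {X : SSet.{u}} : (w' w : Word X) → CubeMap w'.dim w.dim → Prop
  | refl (w : Word X) : WordMap w w (CubeMap.id w.dim)
  | append {w₁ w₁' w₂ w₂' : Word X} {f₁ : CubeMap w₁'.dim w₁.dim} {f₂ : CubeMap w₂'.dim w₂.dim} :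
      WordMap w₁' w₁ f₁ → WordMap w₂' w₂ f₂ →
      WordMap (w₁' ++ w₂') (w₁ ++ w₂) (Word.prodMap f₁ f₂)
  | face_one {n : ℕ} (x : Simp X (n + 2)) (i : Fin (n + 1)) :
      WordMap [⟨n, X.δ i.succ.castSucc x⟩] [⟨n + 1, x⟩] (CubeMap.coface true i)
  | face_zero {a b : ℕ} (x : Simp X (a + b + 2)) :
      WordMap [⟨a, interval X 0 (a + 1) (by omega) x⟩, ⟨b, interval X (a + 1) (b + 1) (by omega) x⟩]
        [⟨a + b + 1, x⟩] (CubeMap.coface (n := a + b) false ⟨a, by omega⟩)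
  | conn {n : ℕ} (x : Simp X (n + 2)) (i : Fin (n + 1)) :
      WordMap [⟨n + 2, X.σ i.succ.castSucc x⟩] [⟨n + 1, x⟩] (CubeMap.coconn i)
  | degen_first {n : ℕ} (x : Simp X (n + 1)) :
      WordMap [⟨n + 1, X.σ 0 x⟩] [⟨n, x⟩] (CubeMap.codegen 0)
  | degen_last {n : ℕ} (x : Simp X (n + 1)) :
      WordMap [⟨n + 1, X.σ (Fin.last (n + 1)) x⟩] [⟨n, x⟩] (CubeMap.codegen (Fin.last n))
  | unit (x : Simp X 1) : WordMap [⟨0, x⟩] [] (CubeMap.id 0)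

/-- The relation `f^* (g^* ⟨w⟩) ∼ f^* ⟨w'⟩` on formal cubes, where `g^* ⟨w⟩ = ⟨w'⟩` is one of the
imposed identities. The pair `(w, f)` stands for the cube `f^* ⟨w⟩`. -/
inductive CobarRel (X : SSet.{u}) (n : ℕ) :
    (Σ w : Word X, CubeMap n w.dim) → (Σ w : Word X, CubeMap n w.dim) → Prop
  | mk {w' w : Word X} {g : CubeMap w'.dim w.dim} (h : WordMap w' w g) (f : CubeMap n w'.dim) :
      CobarRel X n ⟨w, g.comp f⟩ ⟨w', f⟩

/-- The `n`-cubes of the cubical cobar construction. -/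
def CobarCube (X : SSet.{u}) (n : ℕ) : Type u := Quot (CobarRel X n)

namespace CobarCube

variable {X : SSet.{u}}

/-- The cube `f^* ⟨x₁, …, x_k⟩`, where `w = x₁, …, x_k`. -/
def mk {n : ℕ} (w : Word X) (f : CubeMap n w.dim) : CobarCube X n := Quot.mk _ ⟨w, f⟩

def map {m n : ℕ} (f : CubeMap m n) : CobarCube X n → CobarCube X m :=
  Quot.map (fun s => ⟨s.1, s.2.comp f⟩) (by
    rintro _ _ ⟨h, g⟩
    exact CobarRel.mk h (g.comp f))

/-- The product is the concatenation of words. -/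
def mul {k l : ℕ} : CobarCube X k → CobarCube X l → CobarCube X (k + l) :=
  Quot.map₂ (fun s s' => ⟨s.1 ++ s'.1,
      (CubeMap.cast (Word.dim_append s.1 s'.1).symm).comp (s.2.prod s'.2)⟩)
    (by
      rintro ⟨w, f⟩ _ _ ⟨h, g⟩
      have := CobarRel.mk (WordMap.append (.refl w) h)
        ((CubeMap.cast (Word.dim_append _ _).symm).comp (f.prod g))
      rwa [Word.prodMap_comp] at this)
    (by
      rintro _ _ ⟨w, f⟩ ⟨h, g⟩
      have := CobarRel.mk (WordMap.append h (.refl w))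
        ((CubeMap.cast (Word.dim_append _ _).symm).comp (g.prod f))
      rwa [Word.prodMap_comp] at this)

theorem mk_congr {n : ℕ} {w w' : Word X} (h : w = w') (f : CubeMap n w.dim)
    (f' : CubeMap n w'.dim) (hf : f' = (CubeMap.cast (by rw [h])).comp f) : mk w f = mk w' f' := by
  subst h
  subst hf
  rfl

end CobarCube

/-- The cubical cobar construction of a (`1`-reduced) simplicial set, as a cubical monoid. -/
def cubicalCobar (X : SSet.{u}) : CubicalMonoid.{u} where
  cube := CobarCube X
  map := CobarCube.map
  map_id y := by
    induction y using Quot.ind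
    rfl
  map_comp g f y := by
    induction y using Quot.ind
    rfl
  one := CobarCube.mk [] (CubeMap.id 0)
  mul := CobarCube.mul
  map_mul f g y z := by
    induction y using Quot.ind with | _ y
    induction z using Quot.ind with | _ z
    refine CobarCube.mk_congr rfl _ _ ?_
    ext t c
    simp [CubeMap.comp, CubeMap.prod, prodFun, CubeMap.cast]
  one_mul y := by
    induction y using Quot.ind with | _ y
    obtain ⟨w, f⟩ := y
    refine CobarCube.mk_congr rfl _ _ ?_
    ext t c
    simp only [CubeMap.comp, CubeMap.prod, prodFun, CubeMap.cast, CubeMap.id, Fin.append,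
      Fin.addCases]
    rw [dif_neg (by simp [Word.dim])]
    simp only [Fin.natAdd, Fin.cast, eq_rec_constant]
    congr 1
    funext c'
    congr 1
    simp
  mul_one y := by
    induction y using Quot.ind with | _ y
    obtain ⟨w, f⟩ := y
    refine CobarCube.mk_congr (by simp) _ _ ?_
    ext t c
    simp [CubeMap.comp, CubeMap.prod, prodFun, CubeMap.cast, Fin.append, Fin.addCases]
    rfl
  mul_assoc x y z := by
    induction x using Quot.ind with | _ x
    induction y using Quot.ind with | _ y
    induction z using Quot.ind with | _ z
    refine CobarCube.mk_congr (List.append_assoc _ _ _) _ _ ?_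
    ext t c
    simp only [CubeMap.comp, CubeMap.prod, prodFun, CubeMap.cast, Fin.append, Fin.addCases,
      eq_rec_constant, Fin.val_cast, Fin.val_subNat, Fin.val_castLT]
    have h := Word.dim_append x.1 y.1
    split_ifs
    all_goals first
      | omega
      | rfl
      | skip
    congr 1
    · funext c'
      congr 1
      simp [Fin.ext_iff, Nat.add_assoc]
    · simp only [Fin.ext_iff, Fin.val_subNat, Fin.val_cast]
      omega

/-! ### Twisting functions and Szczarba operators -/

/-- The `n`-simplices of a simplicial group. -/
abbrev GSimp (G : SimplicialObject GrpCat.{u}) (n : ℕ) : Type u :=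
  G.obj (op (SimplexCategory.mk n))

/-- A twisting function, of degree `-1`, defined on the simplices of positive dimension. -/
structure TwistingFunction (X : SSet.{u}) (G : SimplicialObject GrpCat.{u}) where
  toFun {n : ℕ} : Simp X (n + 1) → GSimp G n
  δ_zero {n : ℕ} (x : Simp X (n + 2)) :
    G.δ 0 (toFun x) = (toFun (X.δ 0 x))⁻¹ * toFun (X.δ 1 x)
  δ_succ {n : ℕ} (x : Simp X (n + 2)) (k : Fin (n + 1)) :
    G.δ k.succ (toFun x) = toFun (X.δ k.succ.succ x)
  σ_apply {n : ℕ} (x : Simp X (n + 1)) (k : Fin (n + 1)) :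
    G.σ k (toFun x) = toFun (X.σ k.succ x)
  map_σ_zero {n : ℕ} (x : Simp X n) : toFun (X.σ 0 x) = 1

/-- The sequences `(i₁, …, iₙ)` with `0 ≤ i_k ≤ n - k`; the indices `k` are shifted by one. -/
abbrev SzIndex (n : ℕ) : Type := (k : Fin n) → Fin (n - k)

/-- The sum of the components of a sequence. -/
def SzIndex.deg {n : ℕ} (i : SzIndex n) : ℕ := ∑ k, (i k : ℕ)

/-- The derived operator of a simplicial operator, as a map of vertices. -/
def derive (f : ℕ → ℕ) : ℕ → ℕ
  | 0 => 0
  | t + 1 => f t + 1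

/-- The vertex map of the face operator `d_j`. -/
def cofaceNat (j t : ℕ) : ℕ := if t < j then t else t + 1

/-- The vertex map `[n] → [n - k]` of the simplicial operator `D_{i,k}` of Szczarba. With `'`
denoting derived operators, `D_{∅,0} = id` and, for `i = (i₁, l)`, the operator `D_{i,k}` is
`D_{l,k}' s₀ d_{i₁-k}` if `k < i₁`, it is `D_{l,k}'` if `k = i₁`, and `D_{l,k-1}' s₀` if `k > i₁`. -/
def szMap : List ℕ → ℕ → ℕ → ℕ
  | [], _, t => t
  | i :: l, k, t =>
    if k < i then cofaceNat (i - k) (derive (szMap l k) t - 1)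
    else if k = i then derive (szMap l k) t
    else derive (szMap l (k - 1)) t - 1

def SzValid : List ℕ → Prop
  | [] => True
  | i :: l => i ≤ l.length ∧ SzValid l

theorem szValid_ofFn : ∀ (n : ℕ) (f : Fin n → ℕ), (∀ k, f k < n - k) → SzValid (List.ofFn f)
  | 0, _, _ => by simp [SzValid]
  | n + 1, f, h => by
    rw [List.ofFn_succ]
    refine ⟨?_, szValid_ofFn n _ fun k => ?_⟩
    · have := h 0
      simp at this ⊢
      omega
    · have := h k.succ
      simp at this ⊢
      omega

theorem derive_mono {f : ℕ → ℕ} (hf : Monotone f) : Monotone (derive f) := by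
  rintro (_ | a) (_ | b) h
  · exact le_rfl
  · exact Nat.zero_le _
  · omega
  · exact Nat.succ_le_succ (hf (Nat.le_of_succ_le_succ h))

theorem cofaceNat_mono (j : ℕ) : Monotone (cofaceNat j) := by
  intro a b h
  unfold cofaceNat
  split_ifs <;> omega

theorem cofaceNat_le (j t : ℕ) : cofaceNat j t ≤ t + 1 := by
  unfold cofaceNat
  split_ifs <;> omega

theorem szMap_mono : ∀ (l : List ℕ) (k : ℕ), Monotone (szMap l k)
  | [], _ => fun _ _ h => h
  | i :: l, k => by
    intro a b h
    simp only [szMap]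
    split_ifs
    · exact cofaceNat_mono _ (Nat.sub_le_sub_right (derive_mono (szMap_mono l k) h) 1)
    · exact derive_mono (szMap_mono l k) h
    · exact Nat.sub_le_sub_right (derive_mono (szMap_mono l (k - 1)) h) 1

theorem szMap_le : ∀ (l : List ℕ) (k t : ℕ), SzValid l → k ≤ l.length → t ≤ l.length →
    szMap l k t ≤ l.length - k
  | [], _, t => by simp +contextual [szMap]
  | i :: l, k, t => by
    rintro ⟨hi, hl⟩ hk ht
    simp only [szMap, List.length_cons] at *
    split_ifs with h₁ h₂
    · refine (cofaceNat_le _ _).trans ?_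
      rcases t with _ | t
      · simp only [derive]
        omega
      · have := szMap_le l k t hl (by omega) (by omega)
        simp only [derive]
        omega
    · rcases t with _ | t
      · simp [derive]
      · have := szMap_le l k t hl (by omega) (by omega)
        simp only [derive]
        omega
    · rcases t with _ | t
      · simp [derive]
      · have := szMap_le l (k - 1) t hl (by omega) (by omega)
        simp only [derive]
        omega

/-- The sequence as a list. -/
def SzIndex.toList {n : ℕ} (i : SzIndex n) : List ℕ := List.ofFn fun k => (i k : ℕ)

theorem SzIndex.valid {n : ℕ} (i : SzIndex n) : SzValid i.toList :=
  szValid_ofFn n _ fun k => (i k).2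

theorem SzIndex.length_toList {n : ℕ} (i : SzIndex n) : i.toList.length = n := by
  simp [SzIndex.toList]

/-- The operator `D_{i,k}`, from degree `a = n - k` to degree `n`, as a map of simplices. -/
def szHom {n : ℕ} (i : SzIndex n) (k a : ℕ) (h : k + a = n) :
    SimplexCategory.mk n ⟶ SimplexCategory.mk a :=
  SimplexCategory.mkHom
    ⟨fun t => ⟨szMap i.toList k t, by
      have := szMap_le i.toList k t i.valid
      rw [i.length_toList] at this
      have := this (by omega) (by omega)
      omega⟩, fun _ _ hst => szMap_mono i.toList k hst⟩

namespace TwistingFunction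

variable {X : SSet.{u}} {G : SimplicialObject GrpCat.{u}} (τ : TwistingFunction X G)

/-- The element `D_{i,k} τ((d₀)^k x)⁻¹`. -/
def szTerm {n : ℕ} (i : SzIndex n) (k a : ℕ) (h : k + a = n) (x : Simp X (n + 1)) : GSimp G n :=
  G.map (szHom i k a h).op (τ.toFun (interval X k (a + 1) (by omega) x))⁻¹

/-- The Szczarba operator
`Sz_i x = D_{i,0} τ(x)⁻¹ · D_{i,1} τ(d₀ x)⁻¹ ⋯ D_{i,n} τ((d₀)^n x)⁻¹`. -/
def sz {n : ℕ} (i : SzIndex n) (x : Simp X (n + 1)) : GSimp G n :=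
  (List.ofFn fun k : Fin (n + 1) => τ.szTerm i k (n - k) (by omega) x).prod

end TwistingFunction

theorem szIndexOfPerm_aux {n : ℕ} (π : Equiv.Perm (Fin n)) (k : Fin n) :
    (π k : ℕ) + 1 - (Finset.univ.filter fun j => j ≤ k ∧ π j ≤ π k).card < n - k := by
  have h₁ : (Finset.univ.filter fun j => j ≤ k ∧ π j ≤ π k).card +
      (Finset.univ.filter fun j => j ≤ k ∧ ¬ π j ≤ π k).card = k + 1 := by
    rw [← Finset.filter_filter, ← Finset.filter_filter, Finset.card_filter_add_card_filter_not]
    rw [← Fin.card_Iic k]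
    congr 1
    ext
    simp
  have h₂ : (Finset.univ.filter fun j => j ≤ k ∧ ¬ π j ≤ π k).card ≤ n - 1 - π k := by
    rw [← Fin.card_Ioi (π k), ← Finset.card_map π.toEmbedding]
    refine Finset.card_le_card fun c => ?_
    simp only [Finset.mem_map, Finset.mem_filter, Finset.mem_univ, true_and, Finset.mem_Ioi]
    rintro ⟨j, ⟨-, hj⟩, rfl⟩
    simpa using hj
  have := (π k).2
  have := k.2
  omega

/-- The sequence corresponding to a permutation: `i_k = π(k) - #{j ≤ k | π(j) ≤ π(k)}`,
where the values of `π` are numbered starting from `1`. -/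
def szIndexOfPerm {n : ℕ} (π : Equiv.Perm (Fin n)) : SzIndex n := fun k =>
  ⟨(π k : ℕ) + 1 - (Finset.univ.filter fun j => j ≤ k ∧ π j ≤ π k).card, szIndexOfPerm_aux π k⟩

/-- The Szczarba operator indexed by a permutation. -/
def TwistingFunction.szPerm {X : SSet.{u}} {G : SimplicialObject GrpCat.{u}}
    (τ : TwistingFunction X G) {n : ℕ} (π : Equiv.Perm (Fin n)) (x : Simp X (n + 1)) : GSimp G n :=
  τ.sz (szIndexOfPerm π) x

/-! #### Szczarba operators on degenerate simplices -/

theorem szMap_zero : ∀ (l : List ℕ) (k : ℕ), szMap l k 0 = 0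
  | [], _ => rfl
  | i :: l, k => by
    simp only [szMap, derive]
    split_ifs with h
    · simp [cofaceNat, h]
    · rfl
    · rfl

/-- The vertex map of the degeneracy operator `s_j`. -/
def codegenNat (j t : ℕ) : ℕ := if j < t then t - 1 else t

theorem codegenNat_cofaceNat {j m t : ℕ} (h : j + 1 < m) :
    codegenNat j (cofaceNat m t) = cofaceNat (m - 1) (codegenNat j t) := by
  unfold codegenNat cofaceNat
  split_ifs <;> omega

theorem codegenNat_cofaceNat' {j m t : ℕ} (h : m ≤ j) :
    codegenNat (j + 1) (cofaceNat m t) = cofaceNat m (codegenNat j t) := by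
  unfold codegenNat cofaceNat
  split_ifs <;> omega

theorem codegenNat_succ (j t : ℕ) : codegenNat (j + 1) (t + 1) = codegenNat j t + 1 := by
  unfold codegenNat
  split_ifs <;> omega

theorem szMap_collapse : ∀ (l : List ℕ) (p : ℕ), SzValid l → l ≠ [] → p ≤ l.length →
    ∃ q < l.length,
      (∀ k < p, codegenNat (p - k - 1) (szMap l k q) = codegenNat (p - k - 1) (szMap l k (q + 1))) ∧
      ∀ k, p < k → k ≤ l.length → szMap l k q = szMap l k (q + 1)
  | [], _ => by simp
  | i :: l, p => by
    rintro ⟨hi, hl⟩ - hp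
    simp only [List.length_cons] at hp ⊢
    by_cases h₀ : p = i ∨ p = i + 1
    · refine ⟨0, by omega, fun k hk => ?_, fun k hk hk' => ?_⟩
      · rw [szMap_zero]
        simp only [szMap, derive, szMap_zero]
        split_ifs with h₁ h₂
        · simp [cofaceNat, h₁]
        · simp [codegenNat, show p - k - 1 = 0 by omega]
        · rfl
      · rw [szMap_zero]
        simp only [szMap, derive, szMap_zero]
        rw [if_neg (by omega), if_neg (by omega)]
    · have hne : l ≠ [] := by
        rintro rfl
        simp at hi hp
        omega
      by_cases h₁ : p < i
      · obtain ⟨q, hq, hlt, hgt⟩ := szMap_collapse l p hl hne (by omega)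
        refine ⟨q + 1, by omega, fun k hk => ?_, fun k hk hk' => ?_⟩
        · simp only [szMap, derive, if_pos (hk.trans h₁), Nat.add_sub_cancel]
          rw [codegenNat_cofaceNat (by omega), codegenNat_cofaceNat (by omega), hlt k hk]
        · simp only [szMap, derive, Nat.add_sub_cancel]
          split_ifs with h₂ h₃
          · rw [hgt k hk (by omega)]
          · rw [hgt k hk (by omega)]
          · rcases (show p < k - 1 ∨ p = k - 1 by omega) with h | h
            · rw [hgt _ h (by omega)]
            · omega
      · obtain ⟨q, hq, hlt, hgt⟩ := szMap_collapse l (p - 1) hl hne (by omega)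
        refine ⟨q + 1, by omega, fun k hk => ?_, fun k hk hk' => ?_⟩
        · simp only [szMap, derive, Nat.add_sub_cancel]
          split_ifs with h₂ h₃
          · have := hlt k (by omega)
            rw [show p - k - 1 = p - 1 - k - 1 + 1 by omega, codegenNat_cofaceNat' (by omega),
              codegenNat_cofaceNat' (by omega), this]
          · have := hlt k (by omega)
            rw [show p - k - 1 = p - 1 - k - 1 + 1 by omega, codegenNat_succ, codegenNat_succ, this]
          · have := hlt (k - 1) (by omega)
            rwa [show p - 1 - (k - 1) - 1 = p - k - 1 by omega] at this
        · simp only [szMap, derive, Nat.add_sub_cancel]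
          rw [if_neg (by omega), if_neg (by omega), if_neg (by omega), if_neg (by omega),
            hgt _ (by omega) (by omega)]

theorem σ_toOrderHom_val {b : ℕ} (j : Fin (b + 1)) (t : Fin (b + 2)) :
    ((SimplexCategory.σ j).toOrderHom t : ℕ) = codegenNat j t := by
  simp only [SimplexCategory.σ, SimplexCategory.mkHom, SimplexCategory.Hom.toOrderHom_mk,
    Fin.predAboveOrderHom_coe, Fin.predAbove, Fin.lt_def, Fin.val_castSucc, codegenNat]
  split_ifs <;> simp

theorem interval_σ_of_lt (X : SSet.{u}) {n : ℕ} (x : Simp X n) (p : Fin (n + 1)) (k b : ℕ)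
    (hk : k ≤ p) (h : k + b = n) :
    interval X k (b + 1) (by omega) (X.σ p x) =
      X.σ (⟨p - k, by omega⟩ : Fin (b + 1)) (interval X k b (by omega) x) := by
  have e : SimplexCategory.subinterval k (b + 1) (by omega) ≫ SimplexCategory.σ p =
      SimplexCategory.σ (⟨p - k, by omega⟩ : Fin (b + 1)) ≫
        SimplexCategory.subinterval k b (by omega) := by
    ext t : 3
    have hl : ∀ t, ((SimplexCategory.subinterval k (b + 1) (n := n + 1) (by omega)).toOrderHom t : ℕ)
      = t + k := fun _ => rfl
    have hr : ∀ t, ((SimplexCategory.subinterval k b (n := n) (by omega)).toOrderHom t : ℕ)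
      = t + k := fun _ => rfl
    simp only [SimplexCategory.comp_toOrderHom, OrderHom.comp_coe, Function.comp_apply]
    rw [Fin.ext_iff, hr]
    simp only [SimplexCategory.σ, SimplexCategory.mkHom, SimplexCategory.Hom.toOrderHom_mk,
      Fin.predAboveOrderHom_coe, Fin.predAbove, Fin.lt_def, Fin.val_castSucc, hl]
    split_ifs <;> simp only [Fin.val_pred, Fin.coe_castPred, hl] at * <;> omega
  unfold interval SimplicialObject.σ
  rw [← CategoryTheory.comp_apply, ← CategoryTheory.comp_apply, ← X.map_comp, ← X.map_comp,
    ← op_comp, ← op_comp, e]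

theorem interval_succ_σ (X : SSet.{u}) {n : ℕ} (x : Simp X n) (p : Fin (n + 1)) (k b : ℕ)
    (hk : p < k) (h : k + b ≤ n + 1) :
    interval X k b h (X.σ p x) = interval X (k - 1) b (by omega) x := by
  have e : SimplexCategory.subinterval k b h ≫ SimplexCategory.σ p =
      SimplexCategory.subinterval (k - 1) b (by omega) := by
    ext t : 3
    have hl : ∀ t, ((SimplexCategory.subinterval k b (n := n + 1) h).toOrderHom t : ℕ)
      = t + k := fun _ => rfl
    have hr : ∀ t, ((SimplexCategory.subinterval (k - 1) b (n := n) (by omega)).toOrderHom t : ℕ)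
      = t + (k - 1) := fun _ => rfl
    simp only [SimplexCategory.comp_toOrderHom, OrderHom.comp_coe, Function.comp_apply]
    rw [Fin.ext_iff, hr]
    simp only [SimplexCategory.σ, SimplexCategory.mkHom, SimplexCategory.Hom.toOrderHom_mk,
      Fin.predAboveOrderHom_coe, Fin.predAbove, Fin.lt_def, Fin.val_castSucc, hl]
    split_ifs <;> simp only [Fin.val_pred, Fin.coe_castPred, hl] at * <;> omega
  unfold interval SimplicialObject.σ
  rw [← CategoryTheory.comp_apply, ← X.map_comp, ← op_comp, e]

theorem G_map_mem_range {G : SimplicialObject GrpCat.{u}} {n : ℕ} {Δ : SimplexCategory}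
    (θ : SimplexCategory.mk (n + 1) ⟶ Δ) (q : Fin (n + 1))
    (h : θ.toOrderHom q.castSucc = θ.toOrderHom q.succ) (g : G.obj (op Δ)) :
    G.map θ.op g ∈ (G.σ q).hom.range := by
  obtain ⟨θ', rfl⟩ := SimplexCategory.eq_σ_comp_of_not_injective' θ q h
  refine ⟨G.map θ'.op g, ?_⟩
  rw [op_comp, G.map_comp]
  rfl

theorem TwistingFunction.sz_σ {X : SSet.{u}} {G : SimplicialObject GrpCat.{u}}
    (τ : TwistingFunction X G) {n : ℕ} (i : SzIndex (n + 1)) (p : Fin (n + 2))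
    (x : Simp X (n + 1)) : ∃ (q : Fin (n + 1)) (z : GSimp G n), τ.sz i (X.σ p x) = G.σ q z := by
  obtain ⟨q, hq, hlt, hgt⟩ := szMap_collapse i.toList p i.valid
    (by rw [← List.length_pos_iff, i.length_toList]; omega) (by rw [i.length_toList]; omega)
  rw [i.length_toList] at hq hgt
  suffices h : τ.sz i (X.σ p x) ∈ (G.σ (⟨q, hq⟩ : Fin (n + 1))).hom.range by
    obtain ⟨z, hz⟩ := h
    exact ⟨⟨q, hq⟩, z, hz.symm⟩
  refine Subgroup.list_prod_mem _ fun g hg => ?_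
  obtain ⟨k, rfl⟩ := (List.mem_ofFn' _ _).1 hg
  rcases lt_trichotomy (k : ℕ) p with h | h | h
  · obtain ⟨b, hb⟩ : ∃ b, n + 1 - k = b + 1 := ⟨n - k, by omega⟩
    have key : ∀ (a : ℕ) (ha : (k : ℕ) + a = n + 1), a = b + 1 →
        τ.szTerm i k a ha (X.σ p x) ∈ (G.σ (⟨q, hq⟩ : Fin (n + 1))).hom.range := by
      rintro a ha rfl
      have e : (⟨p - k, by omega⟩ : Fin (b + 2)) = (⟨p - k - 1, by omega⟩ : Fin (b + 1)).succ := by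
        ext
        simp
        omega
      unfold TwistingFunction.szTerm
      rw [interval_σ_of_lt X x p k (b + 1) h.le (by omega), e, ← τ.σ_apply, ← map_inv]
      unfold SimplicialObject.σ
      rw [← CategoryTheory.comp_apply, ← G.map_comp, ← op_comp]
      refine G_map_mem_range _ _ ?_ _
      have := hlt k h
      simp only [SimplexCategory.comp_toOrderHom, OrderHom.comp_coe, Function.comp_apply]
      rw [Fin.ext_iff, σ_toOrderHom_val, σ_toOrderHom_val]
      exact this
    exact key _ _ hb
  · have key : ∀ (a : ℕ) (ha : (k : ℕ) + a = n + 1),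
        τ.szTerm i k a ha (X.σ p x) = 1 := by
      intro a ha
      unfold TwistingFunction.szTerm
      rw [interval_σ_of_lt X x p k a h.le ha,
        show (⟨p - k, by omega⟩ : Fin (a + 1)) = 0 by ext; simp [h], τ.map_σ_zero, inv_one, map_one]
    beta_reduce
    rw [key]
    exact Subgroup.one_mem _
  · refine G_map_mem_range _ _ ?_ _
    rw [Fin.ext_iff]
    exact hgt k h (by omega)

theorem TwistingFunction.sz_σ_zero {X : SSet.{u}} {G : SimplicialObject GrpCat.{u}}
    (τ : TwistingFunction X G) (i : SzIndex 0) (p : Fin 1) (x : Simp X 0) :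
    τ.sz i (X.σ p x) = 1 := by
  refine List.prod_eq_one fun g hg => ?_
  obtain ⟨k, rfl⟩ := (List.mem_ofFn' _ _).1 hg
  obtain rfl := Fin.fin_one_eq_zero k
  obtain rfl := Fin.fin_one_eq_zero p
  change τ.szTerm i 0 0 rfl (X.σ 0 x) = 1
  unfold TwistingFunction.szTerm
  rw [interval_σ_of_lt X x 0 0 0 le_rfl rfl]
  erw [τ.map_σ_zero]
  rw [inv_one, map_one]

/-! ### Normalized chains -/

noncomputable section

section NormChains

variable (R : Type v) [CommRing R]

/-- The free module on `S` modulo the submodule spanned by the subset `D`. -/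
abbrev NormChains {S : Type u} (D : Set S) : Type (max u v) :=
  (S →₀ R) ⧸ Submodule.span R ((fun s => Finsupp.single s (1 : R)) '' D)

namespace NormChains

variable {S : Type u} {D : Set S}

/-- The class of a basis element. -/
def of (s : S) : NormChains R D := Submodule.Quotient.mk (Finsupp.single s 1)

variable {R}

theorem of_eq_zero {s : S} (h : s ∈ D) : (of R s : NormChains R D) = 0 :=
  (Submodule.Quotient.mk_eq_zero _).2 (Submodule.subset_span ⟨s, h, rfl⟩)

/-- Linear maps are determined by their values on basis elements, which vanish on `D`. -/
def lift {M : Type*} [AddCommGroup M] [Module R M] (φ : S → M) (h : ∀ s ∈ D, φ s = 0) :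
    NormChains R D →ₗ[R] M :=
  Submodule.liftQ _ (Finsupp.linearCombination R φ) (by
    rw [Submodule.span_le]
    rintro _ ⟨s, hs, rfl⟩
    simp [h s hs])

@[simp]
theorem lift_of {M : Type*} [AddCommGroup M] [Module R M] (φ : S → M) (h : ∀ s ∈ D, φ s = 0)
    (s : S) : lift φ h (of R s : NormChains R D) = φ s := by
  simp [lift, of]

theorem hom_ext {M : Type*} [AddCommGroup M] [Module R M] {f g : NormChains R D →ₗ[R] M}
    (h : ∀ s, f (of R s) = g (of R s)) : f = g := by
  refine Submodule.linearMap_qext _ (Finsupp.lhom_ext' fun s => LinearMap.ext_ring ?_)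
  exact h s

/-- Bilinear maps on pairs of basis elements. -/
def lift₂ {S' : Type u} {D' : Set S'} {M : Type*} [AddCommGroup M] [Module R M]
    (φ : S → S' → M) (h : ∀ s ∈ D, ∀ s', φ s s' = 0) (h' : ∀ s, ∀ s' ∈ D', φ s s' = 0) :
    NormChains R D →ₗ[R] NormChains R D' →ₗ[R] M :=
  lift (fun s => lift (φ s) (h' s)) fun s hs => hom_ext fun s' => by simp [h s hs s']

@[simp]
theorem lift₂_of {S' : Type u} {D' : Set S'} {M : Type*} [AddCommGroup M] [Module R M]
    (φ : S → S' → M) (h : ∀ s ∈ D, ∀ s', φ s s' = 0) (h' : ∀ s, ∀ s' ∈ D', φ s s' = 0)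
    (s : S) (s' : S') : lift₂ φ h h' (of R s) (of R s') = φ s s' := by
  simp [lift₂]

end NormChains

end NormChains

/-- The degenerate simplices of a simplicial set. -/
def degenSimp (X : SSet.{u}) : Set (Σ n, Simp X n) :=
  {s | ∃ (n : ℕ) (i : Fin (n + 1)) (x : Simp X n), s = ⟨n + 1, X.σ i x⟩}

/-- The degenerate simplices of positive dimension, where an `(n + 1)`-simplex is given index `n`. -/
def degenPosSimp (X : SSet.{u}) : Set (Σ n, Simp X (n + 1)) :=
  {s | ∃ (n : ℕ) (i : Fin (n + 1)) (x : Simp X n), s = ⟨n, X.σ i x⟩}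

/-- The degenerate and the folded cubes of a cubical set. -/
def degenCube (Y : CubicalSet.{u}) : Set (Σ n, Y.cube n) :=
  {s | (∃ (n : ℕ) (i : Fin (n + 1)) (y : Y.cube n), s = ⟨n + 1, Y.map (CubeMap.codegen i) y⟩) ∨
    ∃ (n : ℕ) (i : Fin (n + 1)) (y : Y.cube (n + 1)), s = ⟨n + 2, Y.map (CubeMap.coconn i) y⟩}

section Chains

variable (R : Type v) [CommRing R]

/-- Normalized simplicial chains `C(X)`. -/
abbrev Chains (X : SSet.{u}) : Type (max u v) := NormChains R (degenSimp X)

/-- Reduced normalized simplicial chains of a `0`-reduced simplicial set: the normalized chains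
of positive degree. -/
abbrev RedChains (X : SSet.{u}) : Type (max u v) := NormChains R (degenPosSimp X)

/-- Normalized cubical chains `C(Y)`. -/
abbrev CubicalChains (Y : CubicalSet.{u}) : Type (max u v) := NormChains R (degenCube Y)

/-- The chain map `C(f)` induced by a simplicial map. -/
def chainsMap {X Z : SSet.{u}} (f : X ⟶ Z) : Chains R X →ₗ[R] Chains R Z :=
  NormChains.lift (fun s => NormChains.of R ⟨s.1, f.app _ s.2⟩) (by
    rintro _ ⟨n, i, x, rfl⟩
    refine NormChains.of_eq_zero ⟨n, i, f.app _ x, ?_⟩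
    simp only [Sigma.mk.injEq, heq_eq_eq, true_and]
    exact ConcreteCategory.congr_hom (SimplicialObject.σ_naturality f i) x)

theorem degen_triang {Y : CubicalSet.{u}} {n d : ℕ} (y : Y.cube n) (v : CubeSimplex n (d + 1))
    (j : Fin (d + 1)) (h : v j.castSucc = v j.succ) :
    (⟨d + 1, Triang.mk y v⟩ : Σ n, Simp (triang Y) n) ∈ degenSimp (triang Y) := by
  refine ⟨d, j, Triang.mk y (v.comp (SimplexCategory.δ j.succ).toOrderHom), ?_⟩
  have e : v = (v.comp (SimplexCategory.δ j.succ).toOrderHom).comp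
      (SimplexCategory.σ j).toOrderHom := by
    ext t : 2
    change v t = v ((SimplexCategory.δ j.succ).toOrderHom ((SimplexCategory.σ j).toOrderHom t))
    simp only [SimplexCategory.δ, SimplexCategory.σ, SimplexCategory.mkHom,
      SimplexCategory.Hom.toOrderHom_mk, Fin.predAboveOrderHom_coe, OrderEmbedding.toOrderHom_coe,
      Fin.succAboveOrderEmb_apply]
    rcases lt_trichotomy t j.succ with ht | rfl | ht
    · rw [Fin.predAbove_of_le_castSucc _ _ (by
        simp only [Fin.lt_def, Fin.le_def, Fin.val_succ, Fin.val_castSucc] at *; omega)]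
      rw [Fin.succAbove_of_castSucc_lt _ _ (by simpa using ht), Fin.castSucc_castPred]
    · simp [Fin.succAbove_of_castSucc_lt, h]
    · rw [Fin.predAbove_of_castSucc_lt _ _ (by
        simp only [Fin.lt_def, Fin.val_succ, Fin.val_castSucc] at *; omega)]
      rw [Fin.succAbove_of_le_castSucc _ _ (by
        rw [Fin.lt_def, Fin.val_succ] at ht
        rw [Fin.le_def, Fin.val_succ, Fin.val_castSucc, Fin.val_pred]
        omega), Fin.succ_pred]
  conv_lhs => rw [e]
  rfl

theorem ofPerm_apply {n : ℕ} (π : Equiv.Perm (Fin n)) (t : Fin (n + 1)) (c : Fin n) :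
    ofPerm π t c = decide ((π.symm c : ℕ) < t) := rfl

theorem ofPerm_codegen {n : ℕ} (i : Fin (n + 1)) (π : Equiv.Perm (Fin (n + 1))) :
    push (CubeMap.codegen i) (ofPerm π) (π.symm i).castSucc =
      push (CubeMap.codegen i) (ofPerm π) (π.symm i).succ := by
  ext c
  simp only [push_apply, CubeMap.codegen, codegenFun, ofPerm_apply, Fin.val_castSucc,
    Fin.val_succ, decide_eq_decide]
  have : (π.symm (i.succAbove c) : ℕ) ≠ π.symm i := fun h =>
    Fin.succAbove_ne i c (π.symm.injective (Fin.ext h))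
  omega

theorem ofPerm_coconn {n : ℕ} (i : Fin (n + 1)) (π : Equiv.Perm (Fin (n + 2))) :
    push (CubeMap.coconn i) (ofPerm π) (min (π.symm i.castSucc) (π.symm i.succ)).castSucc =
      push (CubeMap.coconn i) (ofPerm π) (min (π.symm i.castSucc) (π.symm i.succ)).succ := by
  ext c
  have h₁ : ∀ c' : Fin (n + 2), (c' : ℕ) ≠ i → (π.symm c' : ℕ) ≠ π.symm i.castSucc :=
    fun c' hc h => hc (congrArg Fin.val (π.symm.injective (Fin.ext h)))
  have h₂ : ∀ c' : Fin (n + 2), (c' : ℕ) ≠ i + 1 → (π.symm c' : ℕ) ≠ π.symm i.succ :=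
    fun c' hc h => hc (congrArg Fin.val (π.symm.injective (Fin.ext h)))
  simp only [push_apply, CubeMap.coconn, coconnFun, ofPerm_apply, Fin.val_castSucc,
    Fin.val_succ, Fin.coe_min, Bool.min_eq_and, ← Bool.decide_and]
  split_ifs with hc hc'
  · have hc : (c : ℕ) < i := hc
    have h₃ := h₁ c.castSucc (by rw [Fin.val_castSucc]; omega)
    have h₄ := h₂ c.castSucc (by rw [Fin.val_castSucc]; omega)
    rw [decide_eq_decide]
    omega
  · subst hc'
    have h₃ := h₁ c.succ (by rw [Fin.val_succ]; omega)
    rw [decide_eq_decide]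
    omega
  · have hc : ¬ (c : ℕ) < i := hc
    have hc' : (c : ℕ) ≠ i := fun h => hc' (Fin.ext h)
    have h₃ := h₁ c.succ (by rw [Fin.val_succ]; omega)
    have h₄ := h₂ c.succ (by rw [Fin.val_succ]; omega)
    rw [decide_eq_decide]
    omega

theorem triangChains_aux {Y : CubicalSet.{u}} (s : Σ n, Y.cube n) (hs : s ∈ degenCube Y)
    (π : Equiv.Perm (Fin s.1)) :
    (⟨s.1, Triang.mk s.2 (ofPerm π)⟩ : Σ n, Simp (triang Y) n) ∈ degenSimp (triang Y) := by
  rcases hs with ⟨n, i, y, rfl⟩ | ⟨n, i, y, rfl⟩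
  · rw [Triang.mk_map]
    exact degen_triang _ _ _ (ofPerm_codegen i π)
  · rw [Triang.mk_map]
    exact degen_triang _ _ _ (ofPerm_coconn i π)

/-- The map `t : C(Y) → C(TY)`, `y ↦ ∑ (-1)^π [y, u_π]`. -/
def triangChains (Y : CubicalSet.{u}) : CubicalChains R Y →ₗ[R] Chains R (triang Y) :=
  NormChains.lift (fun s => ∑ π : Equiv.Perm (Fin s.1),
      ((Equiv.Perm.sign π : ℤˣ) : ℤ) • NormChains.of R ⟨s.1, Triang.mk s.2 (ofPerm π)⟩)
    fun s hs => Finset.sum_eq_zero fun π _ => by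
      rw [NormChains.of_eq_zero (triangChains_aux s hs π), smul_zero]

/-! ### Products of chains -/

theorem mem_degenCube_codegen {Y : CubicalSet.{u}} {m q : ℕ} (i : Fin (q + 1)) (hm : m = q + 1)
    (y : Y.cube q) (f : CubeMap m q)
    (h : ∀ t c, f.toFun t c = t ((i.succAbove c).cast hm.symm)) :
    (⟨m, Y.map f y⟩ : Σ n, Y.cube n) ∈ degenCube Y := by
  subst hm
  have : f = CubeMap.codegen i := by
    ext t c
    exact h t c
  exact Or.inl ⟨q, i, y, by rw [this]⟩

theorem mem_degenCube_coconn {Y : CubicalSet.{u}} {m p q : ℕ} (i : Fin (q + 1)) (hm : m = q + 2)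
    (hp : p = q + 1) (y : Y.cube p) (f : CubeMap m p)
    (h : ∀ t c, f.toFun t c = coconnFun i (fun c => t (c.cast hm.symm)) (c.cast hp)) :
    (⟨m, Y.map f y⟩ : Σ n, Y.cube n) ∈ degenCube Y := by
  subst hm
  subst hp
  have : f = CubeMap.coconn i := by
    ext t c
    exact h t c
  exact Or.inr ⟨q, i, y, by rw [this]⟩

theorem degen_mul_left (Y : CubicalMonoid.{u}) (s : Σ n, Y.cube n)
    (hs : s ∈ degenCube Y.toCubicalSet) (s' : Σ n, Y.cube n) :
    (⟨s.1 + s'.1, Y.mul s.2 s'.2⟩ : Σ n, Y.cube n) ∈ degenCube Y.toCubicalSet := by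
  obtain ⟨l, z⟩ := s'
  rcases hs with ⟨n, i, y, rfl⟩ | ⟨n, i, y, rfl⟩
  · have e := Y.map_mul (CubeMap.codegen i) (CubeMap.id l) y z
    rw [Y.map_id] at e
    dsimp only
    rw [e]
    refine mem_degenCube_codegen ⟨i, by omega⟩ (by omega) _ _ fun t c => ?_
    refine Fin.addCases (fun c => ?_) (fun c => ?_) c
    · simp only [CubeMap.prod, prodFun, Fin.append_left, CubeMap.codegen, codegenFun]
      congr 1
      simp only [Fin.ext_iff, Fin.val_castAdd, Fin.val_cast, Fin.succAbove, Fin.lt_def,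
        Fin.val_castSucc]
      split_ifs <;> rfl
    · simp only [CubeMap.prod, prodFun, Fin.append_right, CubeMap.id]
      congr 1
      simp only [Fin.ext_iff, Fin.val_natAdd, Fin.val_cast, Fin.succAbove, Fin.lt_def,
        Fin.val_castSucc]
      split_ifs <;> simp <;> omega
  · have e := Y.map_mul (CubeMap.coconn i) (CubeMap.id l) y z
    rw [Y.map_id] at e
    dsimp only
    rw [e]
    refine mem_degenCube_coconn (q := n + l) ⟨i, by omega⟩ (by omega) (by omega) _ _ fun t c => ?_
    refine Fin.addCases (fun c => ?_) (fun c => ?_) c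
    · simp only [CubeMap.prod, prodFun, Fin.append_left, CubeMap.coconn, coconnFun, Fin.lt_def,
        Fin.ext_iff, Fin.val_castAdd, Fin.val_cast]
      rfl
    · simp only [CubeMap.prod, prodFun, Fin.append_right, CubeMap.id, coconnFun, Fin.lt_def,
        Fin.ext_iff, Fin.val_natAdd, Fin.val_cast]
      rw [if_neg (by omega), if_neg (by omega)]
      congr 1
      simp only [Fin.ext_iff, Fin.val_natAdd, Fin.val_cast, Fin.val_succ]
      omega

theorem degen_mul_right (Y : CubicalMonoid.{u}) (s s' : Σ n, Y.cube n)
    (hs : s' ∈ degenCube Y.toCubicalSet) :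
    (⟨s.1 + s'.1, Y.mul s.2 s'.2⟩ : Σ n, Y.cube n) ∈ degenCube Y.toCubicalSet := by
  obtain ⟨k, z⟩ := s
  rcases hs with ⟨n, i, y, rfl⟩ | ⟨n, i, y, rfl⟩
  · have e := Y.map_mul (CubeMap.id k) (CubeMap.codegen i) z y
    rw [Y.map_id] at e
    dsimp only
    rw [e]
    refine mem_degenCube_codegen ⟨k + i, by omega⟩ (by omega) _ _ fun t c => ?_
    refine Fin.addCases (fun c => ?_) (fun c => ?_) c
    · simp only [CubeMap.prod, prodFun, Fin.append_left, CubeMap.id]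
      congr 1
      simp only [Fin.ext_iff, Fin.val_castAdd, Fin.val_cast, Fin.succAbove, Fin.lt_def,
        Fin.val_castSucc]
      rw [if_pos (by omega)]
      rfl
    · simp only [CubeMap.prod, prodFun, Fin.append_right, CubeMap.codegen, codegenFun]
      congr 1
      simp only [Fin.ext_iff, Fin.val_natAdd, Fin.val_cast, Fin.succAbove, Fin.lt_def,
        Fin.val_castSucc, Nat.add_lt_add_iff_left]
      split_ifs
      all_goals simp
      all_goals omega
  · have e := Y.map_mul (CubeMap.id k) (CubeMap.coconn i) z y
    rw [Y.map_id] at e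
    dsimp only
    rw [e]
    refine mem_degenCube_coconn (q := k + n) ⟨k + i, by omega⟩ (by omega) (by omega) _ _
      fun t c => ?_
    refine Fin.addCases (fun c => ?_) (fun c => ?_) c
    · simp only [CubeMap.prod, prodFun, Fin.append_left, CubeMap.id, coconnFun, Fin.lt_def,
        Fin.ext_iff, Fin.val_castAdd, Fin.val_cast]
      rw [if_pos (by omega)]
      rfl
    · simp only [CubeMap.prod, prodFun, Fin.append_right, CubeMap.coconn, coconnFun, Fin.lt_def,
        Fin.ext_iff, Fin.val_natAdd, Fin.val_cast, Nat.add_lt_add_iff_left, Nat.add_left_cancel_iff]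
      rfl

/-- The product of cubical chains induced by the product of a cubical monoid. -/
def cubicalMul (Y : CubicalMonoid.{u}) : CubicalChains R Y.toCubicalSet →ₗ[R]
    CubicalChains R Y.toCubicalSet →ₗ[R] CubicalChains R Y.toCubicalSet :=
  NormChains.lift₂ (fun s s' => NormChains.of R ⟨s.1 + s'.1, Y.mul s.2 s'.2⟩)
    (fun s hs s' => NormChains.of_eq_zero (degen_mul_left Y s hs s'))
    (fun s s' hs => NormChains.of_eq_zero (degen_mul_right Y s s' hs))

/-- A `(k, l)`-shuffle `(α, β)`, given by the set `α`; the numbering starts from `0`. -/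
abbrev Shuffle (k l : ℕ) : Type := {α : Finset (Fin (k + l)) // α.card = k}

theorem Shuffle.card_compl {k l : ℕ} (α : Shuffle k l) : (α.1ᶜ).card = l := by
  rw [Finset.card_compl, α.2, Fintype.card_fin]
  omega

/-- The sign of a shuffle: the parity of the number of pairs `b < a` with `a ∈ α`, `b ∈ β`. -/
def Shuffle.sign {k l : ℕ} (α : Shuffle k l) : ℤ :=
  (-1) ^ ((α.1 ×ˢ α.1ᶜ).filter fun c => c.2 < c.1).card

/-- The surjection `[n] → [#α]` whose value at `t` is the number of elements of `α` preceding `t`.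
It gives the iterated degeneracy operator `s_{β_l} ⋯ s_{β_1}`, where `β` is the complement of `α`
and the numbering starts from `0`. -/
def degenHom {n k : ℕ} (α : Finset (Fin n)) (h : α.card = k) :
    SimplexCategory.mk n ⟶ SimplexCategory.mk k :=
  SimplexCategory.mkHom
    ⟨fun t => ⟨(α.filter fun a : Fin n => (a : ℕ) < (t : Fin (n + 1))).card,
      Nat.lt_succ_of_le (h ▸ Finset.card_filter_le _ _)⟩, fun s t hst => by
      refine Finset.card_le_card fun a ha => ?_
      rw [Finset.mem_filter] at ha ⊢
      exact ⟨ha.1, lt_of_lt_of_le ha.2 hst⟩⟩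

/-- The underlying simplicial set of a simplicial group. -/
abbrev toSSet (G : SimplicialObject GrpCat.{u}) : SSet.{u} := G ⋙ forget GrpCat

/-- The product simplex of `g` and `h` in `G` belonging to a shuffle. -/
def shuffleTerm {G : SimplicialObject GrpCat.{u}} {k l : ℕ} (α : Shuffle k l) (g : GSimp G k)
    (h : GSimp G l) : GSimp G (k + l) :=
  G.map (degenHom α.1 α.2).op g * G.map (degenHom α.1ᶜ α.card_compl).op h

theorem exists_degenHom {n k : ℕ} (α : Finset (Fin n)) (h : α.card = k) (i : Fin k) :
    ∃ q ∈ α, ((degenHom α h).toOrderHom q.castSucc : ℕ) = i := by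
  refine ⟨α.orderEmbOfFin h i, Finset.orderEmbOfFin_mem _ _ _, ?_⟩
  change (α.filter fun a : Fin n => a < α.orderEmbOfFin h i).card = i
  have e : (α.filter fun a : Fin n => a < α.orderEmbOfFin h i) =
      (Finset.Iio i).map (α.orderEmbOfFin h).toEmbedding := by
    ext a
    simp only [Finset.mem_filter, Finset.mem_map, Finset.mem_Iio]
    constructor
    · rintro ⟨ha, hlt⟩
      rw [← Finset.mem_coe, ← Finset.range_orderEmbOfFin α h] at ha
      obtain ⟨j, rfl⟩ := ha
      exact ⟨j, (α.orderEmbOfFin h).lt_iff_lt.1 hlt, rfl⟩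
    · rintro ⟨j, hj, rfl⟩
      exact ⟨Finset.orderEmbOfFin_mem _ _ _, (α.orderEmbOfFin h).lt_iff_lt.2 hj⟩
  rw [e, Finset.card_map, Fin.card_Iio]

theorem degenHom_succ_of_mem {n k : ℕ} (α : Finset (Fin n)) (h : α.card = k) {q : Fin n}
    (hq : q ∈ α) : ((degenHom α h).toOrderHom q.succ : ℕ) =
      (degenHom α h).toOrderHom q.castSucc + 1 := by
  change (α.filter fun a : Fin n => (a : ℕ) < q + 1).card =
    (α.filter fun a : Fin n => (a : ℕ) < q).card + 1
  rw [← Finset.card_insert_of_notMem (a := q) (by simp)]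
  congr 1
  ext a
  simp only [Finset.mem_filter, Finset.mem_insert, Nat.lt_succ_iff_lt_or_eq, Fin.val_inj]
  constructor
  · rintro ⟨ha, h | h⟩
    exacts [Or.inr ⟨ha, h⟩, Or.inl h]
  · rintro (rfl | ⟨ha, h⟩)
    exacts [⟨hq, Or.inr rfl⟩, ⟨ha, Or.inl h⟩]

theorem degenHom_succ_of_notMem {n k : ℕ} (α : Finset (Fin n)) (h : α.card = k) {q : Fin n}
    (hq : q ∉ α) : (degenHom α h).toOrderHom q.castSucc = (degenHom α h).toOrderHom q.succ := by
  refine Fin.ext ?_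
  change (α.filter fun a : Fin n => (a : ℕ) < q).card =
    (α.filter fun a : Fin n => (a : ℕ) < q + 1).card
  congr 1
  ext a
  simp only [Finset.mem_filter, Nat.lt_succ_iff_lt_or_eq, Fin.val_inj]
  constructor
  · rintro ⟨ha, h⟩
    exact ⟨ha, Or.inl h⟩
  · rintro ⟨ha, h | rfl⟩
    exacts [⟨ha, h⟩, absurd ha hq]

theorem mem_degenSimp_mul {G : SimplicialObject GrpCat.{u}} {n : ℕ} {Δ Δ' : SimplexCategory}
    (θ : SimplexCategory.mk n ⟶ Δ) (θ' : SimplexCategory.mk n ⟶ Δ') (q : Fin n)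
    (h : θ.toOrderHom q.castSucc = θ.toOrderHom q.succ)
    (h' : θ'.toOrderHom q.castSucc = θ'.toOrderHom q.succ) (g : G.obj (op Δ)) (g' : G.obj (op Δ')) :
    (⟨n, (G.map θ.op g * G.map θ'.op g' : GSimp G n)⟩ : Σ n, Simp (toSSet G) n) ∈
      degenSimp (toSSet G) := by
  cases n with
  | zero => exact q.elim0
  | succ n =>
    obtain ⟨z, hz⟩ := Subgroup.mul_mem _ (G_map_mem_range θ q h g) (G_map_mem_range θ' q h' g')
    refine ⟨n, q, z, ?_⟩
    rw [← hz]
    rfl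

theorem σ_degenHom {n k : ℕ} (α : Finset (Fin n)) (h : α.card = k + 1) (i : Fin (k + 1)) {q : Fin n}
    (hq : q ∈ α) (hi : ((degenHom α h).toOrderHom q.castSucc : ℕ) = i) :
    (degenHom α h ≫ SimplexCategory.σ i).toOrderHom q.castSucc =
      (degenHom α h ≫ SimplexCategory.σ i).toOrderHom q.succ := by
  refine Fin.ext ?_
  simp only [SimplexCategory.comp_toOrderHom, OrderHom.comp_coe, Function.comp_apply]
  rw [σ_toOrderHom_val, σ_toOrderHom_val, degenHom_succ_of_mem α h hq, hi]
  simp [codegenNat]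

theorem shuffleTerm_degen_left {G : SimplicialObject GrpCat.{u}} (s s' : Σ n, Simp (toSSet G) n)
    (hs : s ∈ degenSimp (toSSet G)) (α : Shuffle s.1 s'.1) :
    (⟨s.1 + s'.1, shuffleTerm (G := G) α s.2 s'.2⟩ : Σ n, Simp (toSSet G) n) ∈
      degenSimp (toSSet G) := by
  obtain ⟨k, i, g, rfl⟩ := hs
  obtain ⟨q, hq, hi⟩ := exists_degenHom α.1 α.2 i
  have := mem_degenSimp_mul (G := G) (degenHom α.1 α.2 ≫ SimplexCategory.σ i)
    (degenHom α.1ᶜ α.card_compl) q (σ_degenHom _ _ _ hq hi)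
    (degenHom_succ_of_notMem _ _ (by simpa using hq)) g s'.2
  rw [op_comp, G.map_comp] at this
  exact this

theorem shuffleTerm_degen_right {G : SimplicialObject GrpCat.{u}} (s s' : Σ n, Simp (toSSet G) n)
    (hs : s' ∈ degenSimp (toSSet G)) (α : Shuffle s.1 s'.1) :
    (⟨s.1 + s'.1, shuffleTerm (G := G) α s.2 s'.2⟩ : Σ n, Simp (toSSet G) n) ∈
      degenSimp (toSSet G) := by
  obtain ⟨l, i, g, rfl⟩ := hs
  obtain ⟨q, hq, hi⟩ := exists_degenHom α.1ᶜ α.card_compl i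
  have := mem_degenSimp_mul (G := G) (degenHom α.1 α.2)
    (degenHom α.1ᶜ α.card_compl ≫ SimplexCategory.σ i) q
    (degenHom_succ_of_notMem _ _ (by simpa using hq)) (σ_degenHom _ _ _ hq hi) s.2 g
  rw [op_comp, G.map_comp] at this
  exact this

/-- The product on `C(G)`: the shuffle map followed by the map induced by `G × G → G`. -/
def shuffleMul (G : SimplicialObject GrpCat.{u}) :
    Chains R (toSSet G) →ₗ[R] Chains R (toSSet G) →ₗ[R] Chains R (toSSet G) :=
  NormChains.lift₂ (fun s s' => ∑ α : Shuffle s.1 s'.1,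
      α.sign • NormChains.of R ⟨s.1 + s'.1, shuffleTerm (G := G) α s.2 s'.2⟩)
    (fun s hs s' => Finset.sum_eq_zero fun α _ => by
      rw [NormChains.of_eq_zero (shuffleTerm_degen_left s s' hs α), smul_zero])
    (fun s s' hs => Finset.sum_eq_zero fun α _ => by
      rw [NormChains.of_eq_zero (shuffleTerm_degen_right s s' hs α), smul_zero])

/-! ### Cobar construction and Szczarba map -/

/-- The (underlying algebra of the) reduced cobar construction `Ω C(X)`: the tensor algebra of the
desuspension of the reduced chains. -/
abbrev Cobar (X : SSet.{u}) : Type (max u v) := TensorAlgebra R (RedChains R X)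

variable {R}

/-- The map `⟨m₁|⋯|m_k⟩ ↦ t(m₁) ⋯ t(m_k)` from a tensor algebra to a module `A` with product `μ`
and unit `e`. -/
def wordMap {M A : Type*} [AddCommGroup M] [Module R M] [AddCommGroup A] [Module R A]
    (μ : A →ₗ[R] A →ₗ[R] A) (e : A) (t : M →ₗ[R] A) : TensorAlgebra R M →ₗ[R] A :=
  LinearMap.applyₗ e ∘ₗ
    (TensorAlgebra.lift R (A := Module.End R A) (μ ∘ₗ t)).toLinearMap

theorem wordMap_one {M A : Type*} [AddCommGroup M] [Module R M] [AddCommGroup A] [Module R A]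
    (μ : A →ₗ[R] A →ₗ[R] A) (e : A) (t : M →ₗ[R] A) : wordMap μ e t 1 = e := by
  simp [wordMap]

theorem wordMap_ι_mul {M A : Type*} [AddCommGroup M] [Module R M] [AddCommGroup A] [Module R A]
    (μ : A →ₗ[R] A →ₗ[R] A) (e : A) (t : M →ₗ[R] A) (m : M) (w : TensorAlgebra R M) :
    wordMap μ e t (TensorAlgebra.ι R m * w) = μ (t m) (wordMap μ e t w) := by
  simp [wordMap]

variable (R)

/-- The cube `⟨x⟩` of the cubical cobar construction. -/
abbrev cobarCell {X : SSet.{u}} {n : ℕ} (x : Simp X (n + 1)) : (cubicalCobar X).cube n :=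
  CobarCube.mk [⟨n, x⟩] (CubeMap.id n)

theorem cobarCell_degen {X : SSet.{u}} {n : ℕ} (i : Fin (n + 2)) (x : Simp X (n + 1)) :
    (⟨n + 1, cobarCell (X.σ i x)⟩ : Σ n, (cubicalCobar X).cube n) ∈
      degenCube (cubicalCobar X).toCubicalSet := by
  have key : ∀ {m : ℕ} {w : Word X} {g : CubeMap (m + 0) w.dim} {y : Simp X (m + 1)},
      WordMap [⟨m, y⟩] w g → (cubicalCobar X).map g (CobarCube.mk w (CubeMap.id _)) = cobarCell y :=
    fun h => Quot.sound (CobarRel.mk h (CubeMap.id _))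
  by_cases h₀ : i = 0
  · subst h₀
    exact Or.inl ⟨n, 0, cobarCell x, by rw [← key (WordMap.degen_first x)]; rfl⟩
  by_cases h₁ : i = Fin.last (n + 1)
  · subst h₁
    exact Or.inl ⟨n, Fin.last n, cobarCell x, by rw [← key (WordMap.degen_last x)]; rfl⟩
  · obtain ⟨j, rfl⟩ := Fin.exists_succ_eq.2 h₀
    obtain ⟨m, rfl⟩ : ∃ m, n = m + 1 := by
      refine Nat.exists_eq_succ_of_ne_zero ?_
      rintro rfl
      exact h₁ (by rw [Fin.fin_one_eq_zero j]; rfl)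
    obtain ⟨j', rfl⟩ : ∃ j' : Fin (m + 1), j = j'.castSucc := by
      refine ⟨j.castPred ?_, (Fin.castSucc_castPred _ _).symm⟩
      rintro rfl
      exact h₁ (by simp)
    refine Or.inr ⟨m, j', cobarCell x, ?_⟩
    rw [Fin.succ_castSucc, ← key (WordMap.conn x j')]
    rfl

/-- The map `C̄(X) → C(Ω̂X)`, `x ↦ ⟨x⟩`. It vanishes on the (degenerate) `1`-simplices of a
`1`-reduced simplicial set `X`. -/
def cubeOf (X : SSet.{u}) : RedChains R X →ₗ[R] CubicalChains R (cubicalCobar X).toCubicalSet :=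
  NormChains.lift (fun s => if s.1 = 0 then 0 else NormChains.of R ⟨s.1, cobarCell s.2⟩) (by
    rintro _ ⟨_ | n, i, x, rfl⟩
    · simp
    · rw [if_neg (Nat.succ_ne_zero n), NormChains.of_eq_zero (cobarCell_degen i x)])

/-- The algebra map `ΩC(X) → C(Ω̂X)` with `⟨x₁, …, x_k⟩ ↦ ⟨x₁, …, x_k⟩`. -/
def cobarToCubical (X : SSet.{u}) : Cobar R X →ₗ[R] CubicalChains R (cubicalCobar X).toCubicalSet :=
  wordMap (cubicalMul R (cubicalCobar X)) (NormChains.of R ⟨0, (cubicalCobar X).one⟩) (cubeOf R X)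

/-- Szczarba's twisting cochain: `t_Sz(x) = Sz_∅ x - 1` for `x` of dimension `1`, and
`t_Sz(x) = ∑ (-1)^|i| Sz_i x` for `x` of greater dimension. -/
def szCochain {X : SSet.{u}} {G : SimplicialObject GrpCat.{u}} (τ : TwistingFunction X G) :
    RedChains R X →ₗ[R] Chains R (toSSet G) :=
  NormChains.lift (fun s => ∑ i : SzIndex s.1, (-1 : ℤ) ^ i.deg • NormChains.of R ⟨s.1, τ.sz i s.2⟩ -
      if s.1 = 0 then NormChains.of R ⟨0, (1 : GSimp G 0)⟩ else 0) (by
    rintro _ ⟨_ | n, p, x, rfl⟩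
    · rw [Fintype.sum_unique, τ.sz_σ_zero]
      simp [SzIndex.deg]
    · rw [if_neg (Nat.succ_ne_zero n), sub_zero]
      refine Finset.sum_eq_zero fun i _ => ?_
      obtain ⟨q, z, hz⟩ := τ.sz_σ i p x
      have : (⟨n + 1, τ.sz i (X.σ p x)⟩ : Σ n, Simp (toSSet G) n) ∈ degenSimp (toSSet G) :=
        ⟨n, q, z, by rw [hz]; rfl⟩
      rw [NormChains.of_eq_zero this, smul_zero])

/-- The Szczarba map `f_Sz : ΩC(X) → C(G)` induced by Szczarba's twisting cochain. -/
def szMapCobar {X : SSet.{u}} {G : SimplicialObject GrpCat.{u}} (τ : TwistingFunction X G) :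
    Cobar R X →ₗ[R] Chains R (toSSet G) :=
  wordMap (shuffleMul R G) (NormChains.of R ⟨0, (1 : GSimp G 0)⟩) (szCochain R τ)

/-- The underlying simplicial map of a morphism of simplicial monoids into a simplicial group. -/
def toSSetHom {Y : CubicalMonoid.{u}} {G : SimplicialObject GrpCat.{u}}
    (f : triangMonoid Y ⟶ G ⋙ forget₂ GrpCat MonCat) : triang Y.toCubicalSet ⟶ toSSet G where
  app Δ := ↾fun z => f.app Δ z
  naturality Δ Δ' g := by
    ext z
    exact ConcreteCategory.congr_hom (f.naturality g) z

end Chains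

end

end SzCobar

open SzCobar

/-!
Szczarba's operators become transparent once they are read on the vertices of a cube. For a vertex
`v` of the `n`-cube let `θ_k(v)` be the number of consecutive coordinates of `v` which are equal
to `1`, counting from the position `k` on. The map `θ_k` is a monotone map from the vertices of the
cube to `[n - k]`, and along the path of vertices of the top-dimensional simplex `u_π` it is the
vertex map of the operator `D_{i,k}`, where `i` is the sequence belonging to `π`: Szczarba's
recursion for `D_{i,k}` describes how `θ_k` changes when the coordinate `π(1)`, which is
the first one to become `1`, is inserted (`szHom_szIndexOfPerm`). Hence there is a closed formula
`[⟨x⟩, u] ↦ (θ₀ ∘ u)^* τ(x)⁻¹ · (θ₁ ∘ u)^* τ(d₀x)⁻¹ ⋯ (θₙ ∘ u)^* τ(d₀ⁿx)⁻¹`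
for arbitrary simplices `u` of the cube (`cellValue`), which is visibly compatible with simplicial
operators acting on `u` and agrees with `Sz_π x` for `u = u_π` (`cellValue_ofPerm`).

The formula respects the relations of the cubical cobar construction. For connections and
degeneracies, exactly one factor is trivial because of `τ(s₀y) = 1` (`cellValue_σ`). For the faces
`d⁰ᵢ` the product splits into two (`cellValue_face_zero`). For the faces `d¹ᵢ` the factors `i`
and `i + 1` combine because of `d₀τ(y) = τ(d₀y)⁻¹τ(d₁y)`
(`cellValue_face_one`). Finally, `τ` is trivial on `1`-simplices since they are degenerate. This gives
the morphism (`szMorphism`). It is unique because every simplex of a cube is the image of some `u_π`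
under a simplicial operator: sort the coordinates by the time at which they become `1`
(`exists_ofPerm_comp`, `triangMonoid_hom_ext`).

For the second part, both maps are determined by a map on generators and by
multiplicativity (`comp_wordMap`). On generators, one uses that `π ↦ i` is a bijection for which
`i_k` counts the inversions starting at `k`, so that the sign of `π` is `(-1)^{i₁ + ⋯ + iₙ}`
(`szIndexOfPerm_bijective`, `sign_eq_neg_one_pow_deg`). The map `C(Y) → C(TY) → C(G)` is
multiplicative for every cubical monoid `Y` because a permutation of `k + l` letters amounts to a
`(k, l)`-shuffle and permutations of `k` and of `l` letters (`chainsMap_triangChains_mul`).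
-/

namespace SzCobar

/-! ### The first vanishing coordinate of a vertex of a cube -/

namespace Vert

/-- The coordinates of a vertex, extended by `0` to all natural numbers. -/
def extend {n : ℕ} (t : Vert n) (j : ℕ) : Bool := if h : j < n then t ⟨j, h⟩ else false

theorem extend_of_le {n : ℕ} (t : Vert n) {j : ℕ} (h : n ≤ j) : extend t j = false :=
  dif_neg (by omega)

theorem extend_val {n : ℕ} (t : Vert n) (j : Fin n) : extend t j = t j := dif_pos j.2

theorem extend_mono {n : ℕ} {s t : Vert n} (h : s ≤ t) (j : ℕ) :
    extend s j = true → extend t j = true := by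
  unfold extend
  split_ifs with hj
  · exact h _
  · exact id

/-- The position of the first vanishing coordinate at or after the position `k`; it is `n` if there
is none and `k ≤ n`. -/
def firstZero {n : ℕ} (t : Vert n) (k : ℕ) : ℕ :=
  Nat.find (p := fun j => k ≤ j ∧ extend t j = false)
    ⟨max k n, le_max_left _ _, extend_of_le t (le_max_right _ _)⟩

theorem le_firstZero {n : ℕ} (t : Vert n) (k : ℕ) : k ≤ firstZero t k :=
  (Nat.find_spec (p := fun j => k ≤ j ∧ extend t j = false) _).1

theorem extend_firstZero {n : ℕ} (t : Vert n) (k : ℕ) : extend t (firstZero t k) = false :=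
  (Nat.find_spec (p := fun j => k ≤ j ∧ extend t j = false) _).2

theorem extend_of_lt_firstZero {n : ℕ} (t : Vert n) {j k : ℕ} (hk : k ≤ j) (h : j < firstZero t k) :
    extend t j = true := by
  have := Nat.find_min (p := fun j => k ≤ j ∧ extend t j = false) _ h
  simpa [hk] using this

theorem firstZero_eq {n : ℕ} {t : Vert n} {k e : ℕ} (hk : k ≤ e) (he : extend t e = false)
    (h : ∀ j, k ≤ j → j < e → extend t j = true) : firstZero t k = e := by
  refine (Nat.find_eq_iff _).2 ⟨⟨hk, he⟩, ?_⟩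
  rintro j hj ⟨h₁, h₂⟩
  simp [h j h₁ hj] at h₂

theorem firstZero_le {n : ℕ} (t : Vert n) {k : ℕ} (hk : k ≤ n) : firstZero t k ≤ n := by
  by_contra! h
  simpa [extend_of_le] using extend_of_lt_firstZero t hk h

theorem firstZero_mono {n : ℕ} {s t : Vert n} (h : s ≤ t) (k : ℕ) :
    firstZero s k ≤ firstZero t k := by
  by_contra! h'
  have := extend_mono h _ (extend_of_lt_firstZero s (le_firstZero t k) h')
  simp [extend_firstZero] at this

theorem extend_cofaceFun {n : ℕ} (ε : Bool) (i : Fin (n + 1)) (t : Vert n) (j : ℕ) :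
    extend (cofaceFun ε i t) j =
      if j < i then extend t j else if j = i then ε else extend t (j - 1) := by
  by_cases hj : j < n + 1
  · obtain ⟨j, rfl⟩ : ∃ j' : Fin (n + 1), (j' : ℕ) = j := ⟨⟨j, hj⟩, rfl⟩
    rw [extend_val]
    rcases Fin.eq_self_or_eq_succAbove i j with rfl | ⟨c, rfl⟩
    · simp [cofaceFun]
    · rw [cofaceFun, Fin.insertNth_apply_succAbove, ← extend_val t c]
      have : (i.succAbove c : ℕ) = if (c : ℕ) < i then (c : ℕ) else c + 1 := by
        simp only [Fin.succAbove, Fin.lt_def, Fin.val_castSucc]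
        split_ifs <;> rfl
      rw [this]
      split_ifs
      all_goals first | rfl | omega
  · rw [extend_of_le _ (by omega), if_neg (by omega), if_neg (by omega), extend_of_le _ (by omega)]

theorem extend_codegenFun {n : ℕ} (i : Fin (n + 1)) (t : Vert (n + 1)) (j : ℕ) :
    extend (codegenFun i t) j = if j < i then extend t j else extend t (j + 1) := by
  by_cases hj : j < n
  · obtain ⟨j, rfl⟩ : ∃ j' : Fin n, (j' : ℕ) = j := ⟨⟨j, hj⟩, rfl⟩
    rw [extend_val]
    simp only [codegenFun, ← extend_val, Fin.succAbove, Fin.lt_def, Fin.val_castSucc]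
    split_ifs <;> simp
  · rw [extend_of_le _ (by omega), extend_of_le t (j := j + 1) (by omega), if_neg (by omega)]

theorem extend_coconnFun {n : ℕ} (i : Fin (n + 1)) (t : Vert (n + 2)) (j : ℕ) :
    extend (coconnFun i t) j = if j < i then extend t j else if j = i then
      extend t j && extend t (j + 1) else extend t (j + 1) := by
  by_cases hj : j < n + 1
  · obtain ⟨j, rfl⟩ : ∃ j' : Fin (n + 1), (j' : ℕ) = j := ⟨⟨j, hj⟩, rfl⟩
    rw [extend_val]
    simp only [coconnFun, ← extend_val, Fin.lt_def, Fin.ext_iff, Fin.val_castSucc, Fin.val_succ]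
    rfl
  · rw [extend_of_le _ (by omega), extend_of_le t (j := j + 1) (by omega), if_neg (by omega),
      if_neg (by omega)]

theorem firstZero_cofaceFun_true {n : ℕ} (i : Fin (n + 1)) (t : Vert n) {k : ℕ} (hk : k ≤ i) :
    firstZero (cofaceFun true i t) k = cofaceNat i (firstZero t k) := by
  have h₁ := le_firstZero t k
  have h₂ := extend_firstZero t k
  unfold cofaceNat
  split_ifs with h
  · refine firstZero_eq h₁ (by rw [extend_cofaceFun, if_pos h, h₂]) fun j hj hj' => ?_
    rw [extend_cofaceFun, if_pos (by omega)]
    exact extend_of_lt_firstZero t hj hj'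
  · refine firstZero_eq (by omega) ?_ fun j hj hj' => ?_
    · rw [extend_cofaceFun, if_neg (by omega), if_neg (by omega), Nat.add_sub_cancel, h₂]
    · rw [extend_cofaceFun]
      split_ifs
      · exact extend_of_lt_firstZero t hj (by omega)
      · rfl
      · exact extend_of_lt_firstZero t (k := k) (by omega) (by omega)

theorem firstZero_cofaceFun {n : ℕ} (ε : Bool) (i : Fin (n + 1)) (t : Vert n) {k : ℕ} (hk : i ≤ k) :
    firstZero (cofaceFun ε i t) (k + 1) = firstZero t k + 1 := by
  have h₁ := le_firstZero t k
  refine firstZero_eq (by omega) ?_ fun j hj hj' => ?_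
  · rw [extend_cofaceFun, if_neg (by omega), if_neg (by omega), Nat.add_sub_cancel, extend_firstZero]
  · rw [extend_cofaceFun, if_neg (by omega), if_neg (by omega)]
    exact extend_of_lt_firstZero t (k := k) (by omega) (by omega)

theorem firstZero_codegenFun {n : ℕ} (i : Fin (n + 1)) (t : Vert (n + 1)) {k : ℕ} (hk : i ≤ k) :
    firstZero (codegenFun i t) k = firstZero t (k + 1) - 1 := by
  have h₁ := le_firstZero t (k + 1)
  refine firstZero_eq (by omega) ?_ fun j hj hj' => ?_
  · rw [extend_codegenFun, if_neg (by omega), Nat.sub_add_cancel (by omega), extend_firstZero]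
  · rw [extend_codegenFun, if_neg (by omega)]
    exact extend_of_lt_firstZero t (k := k + 1) (by omega) (by omega)

theorem firstZero_codegenFun_last {n : ℕ} (t : Vert (n + 1)) {k : ℕ} (hk : k ≤ n) :
    firstZero (codegenFun (Fin.last n) t) k = codegenNat n (firstZero t k) := by
  have h₁ := le_firstZero t k
  have h₂ := extend_firstZero t k
  have h₃ := firstZero_le t (k := k) (by omega)
  have : firstZero t k = n + 1 ∨ firstZero t k ≤ n := by omega
  have e : codegenNat n (firstZero t k) = min n (firstZero t k) := by
    unfold codegenNat
    split_ifs <;> omega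
  rw [e]
  refine firstZero_eq (by omega) ?_ fun j hj hj' => ?_
  · rw [extend_codegenFun, Fin.val_last]
    split_ifs with h
    · rwa [min_eq_right (by omega)]
    · exact extend_of_le _ (by omega)
  · rw [extend_codegenFun, Fin.val_last, if_pos (by omega)]
    exact extend_of_lt_firstZero t hj (by omega)

theorem firstZero_coconnFun {n : ℕ} (i : Fin (n + 1)) (t : Vert (n + 2)) {k : ℕ} (hk : k ≤ i) :
    firstZero (coconnFun i t) k = codegenNat i (firstZero t k) := by
  have h₁ := le_firstZero t k
  have h₂ := extend_firstZero t k
  unfold codegenNat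
  split_ifs with h
  · refine firstZero_eq (by omega) ?_ fun j hj hj' => ?_
    · rw [extend_coconnFun, if_neg (by omega), Nat.sub_add_cancel (by omega), h₂]
      simp
    · rw [extend_coconnFun]
      have := extend_of_lt_firstZero t hj (by omega)
      have := extend_of_lt_firstZero t (j := j + 1) (k := k) (by omega) (by omega)
      split_ifs <;> simp_all
  · refine firstZero_eq (by omega) ?_ fun j hj hj' => ?_
    · rw [extend_coconnFun, h₂]
      split_ifs
      · rfl
      · rfl
      · omega
    · rw [extend_coconnFun, if_pos (by omega)]
      exact extend_of_lt_firstZero t hj (by omega)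

theorem firstZero_coconnFun_of_lt {n : ℕ} (i : Fin (n + 1)) (t : Vert (n + 2)) {k : ℕ}
    (hk : i < k) :
    firstZero (coconnFun i t) k = firstZero t (k + 1) - 1 := by
  have h₁ := le_firstZero t (k + 1)
  refine firstZero_eq (by omega) ?_ fun j hj hj' => ?_
  · rw [extend_coconnFun, if_neg (by omega), if_neg (by omega), Nat.sub_add_cancel (by omega),
      extend_firstZero]
  · rw [extend_coconnFun, if_neg (by omega), if_neg (by omega)]
    exact extend_of_lt_firstZero t (k := k + 1) (by omega) (by omega)

/-- Before a vanishing coordinate `a`, the first zero only depends on the first `a` coordinates. -/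
theorem firstZero_cofaceFun_false_of_le {a b : ℕ} (t : Vert (a + b)) {k : ℕ} (hk : k ≤ a) :
    firstZero (cofaceFun false ⟨a, by omega⟩ t) k =
      firstZero (fun c => t (Fin.castAdd b c) : Vert a) k := by
  set s : Vert a := fun c => t (Fin.castAdd b c)
  have h₃ := firstZero_le s hk
  have hs : ∀ j < a, extend t j = extend s j := fun j hj => by
    rw [extend, extend, dif_pos (by omega), dif_pos hj]
    rfl
  refine firstZero_eq (le_firstZero s k) ?_ fun j hj hj' => ?_
  · rw [extend_cofaceFun]
    dsimp only
    split_ifs with h h'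
    · rw [hs _ h, extend_firstZero]
    · rfl
    · omega
  · rw [extend_cofaceFun, if_pos (show j < a by omega), hs _ (by omega)]
    exact extend_of_lt_firstZero s hj hj'

theorem firstZero_natAdd {a b : ℕ} (t : Vert (a + b)) (k : ℕ) :
    firstZero t (a + k) = a + firstZero (fun c => t (Fin.natAdd a c) : Vert b) k := by
  set s : Vert b := fun c => t (Fin.natAdd a c)
  have hs : ∀ j, extend t (a + j) = extend s j := fun j => by
    by_cases hj : j < b
    · rw [extend, extend, dif_pos (by omega), dif_pos hj]
      rfl
    · rw [extend_of_le _ (by omega), extend_of_le _ (by omega)]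
  refine firstZero_eq (Nat.add_le_add_left (le_firstZero s k) a) (by rw [hs, extend_firstZero])
    fun j hj hj' => ?_
  obtain ⟨j, rfl⟩ := Nat.exists_eq_add_of_le (show a ≤ j by omega)
  rw [hs]
  exact extend_of_lt_firstZero s (k := k) (by omega) (by omega)

end Vert

/-! ### Faces and intervals of simplices -/

theorem δ_toOrderHom_val {b : ℕ} (j : Fin (b + 2)) (t : Fin (b + 1)) :
    ((SimplexCategory.δ j).toOrderHom t : ℕ) = cofaceNat j t := by
  simp only [SimplexCategory.δ, SimplexCategory.mkHom, SimplexCategory.Hom.toOrderHom_mk,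
    OrderEmbedding.toOrderHom_coe, Fin.succAboveOrderEmb_apply, Fin.succAbove, Fin.lt_def,
    Fin.val_castSucc, cofaceNat]
  split_ifs <;> simp

theorem subinterval_toOrderHom_val {n k b : ℕ} (h : k + b ≤ n) (t : Fin (b + 1)) :
    ((SimplexCategory.subinterval k b h).toOrderHom t : ℕ) = t + k := rfl

/-- Morphisms of the simplex category are determined by their values as natural numbers. -/
theorem simplexHom_ext {m n : ℕ} {φ ψ : SimplexCategory.mk m ⟶ SimplexCategory.mk n}
    (h : ∀ t : Fin (m + 1), (φ.toOrderHom t : ℕ) = ψ.toOrderHom t) : φ = ψ := by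
  ext t : 3
  exact Fin.ext (h t)

section Interval

variable (X : SSet.{u})

theorem interval_δ_of_le {n : ℕ} (x : Simp X (n + 1)) (i : Fin (n + 2)) (k b : ℕ) (hk : k ≤ i)
    (h : k + b = n) :
    interval X k b h.le (X.δ i x) =
      X.δ (⟨i - k, by omega⟩ : Fin (b + 2)) (interval X k (b + 1) (by omega) x) := by
  have e : SimplexCategory.subinterval k b h.le ≫ SimplexCategory.δ i =
      SimplexCategory.δ (⟨i - k, by omega⟩ : Fin (b + 2)) ≫
        SimplexCategory.subinterval k (b + 1) (by omega) := by
    refine simplexHom_ext fun t => ?_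
    simp only [SimplexCategory.comp_toOrderHom, OrderHom.comp_coe, Function.comp_apply]
    rw [δ_toOrderHom_val, subinterval_toOrderHom_val, subinterval_toOrderHom_val, δ_toOrderHom_val]
    simp only [cofaceNat]
    split_ifs <;> omega
  unfold interval SimplicialObject.δ
  rw [← CategoryTheory.comp_apply, ← CategoryTheory.comp_apply, ← X.map_comp, ← X.map_comp,
    ← op_comp, ← op_comp, e]

theorem interval_δ_of_ge {n : ℕ} (x : Simp X (n + 1)) (i : Fin (n + 2)) (k b : ℕ) (hk : i ≤ k)
    (h : k + b ≤ n) :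
    interval X k b h (X.δ i x) = interval X (k + 1) b (by omega) x := by
  have e : SimplexCategory.subinterval k b h ≫ SimplexCategory.δ i =
      SimplexCategory.subinterval (k + 1) b (by omega) := by
    refine simplexHom_ext fun t => ?_
    simp only [SimplexCategory.comp_toOrderHom, OrderHom.comp_coe, Function.comp_apply]
    rw [δ_toOrderHom_val, subinterval_toOrderHom_val, subinterval_toOrderHom_val]
    simp only [cofaceNat]
    split_ifs <;> omega
  unfold interval SimplicialObject.δ
  rw [← CategoryTheory.comp_apply, ← X.map_comp, ← op_comp, e]

theorem interval_interval {n : ℕ} (x : Simp X n) (k l k' l' : ℕ) (h : k + l ≤ n)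
    (h' : k' + l' ≤ l) :
    interval X k' l' h' (interval X k l h x) = interval X (k + k') l' (by omega) x := by
  have e : SimplexCategory.subinterval k' l' h' ≫ SimplexCategory.subinterval k l h =
      SimplexCategory.subinterval (k + k') l' (by omega) := by
    refine simplexHom_ext fun t => ?_
    simp only [SimplexCategory.comp_toOrderHom, OrderHom.comp_coe, Function.comp_apply]
    rw [subinterval_toOrderHom_val, subinterval_toOrderHom_val, subinterval_toOrderHom_val]
    omega
  unfold interval
  rw [← CategoryTheory.comp_apply, ← X.map_comp, ← op_comp, e]

theorem δ_zero_interval {n : ℕ} (x : Simp X n) (k b : ℕ) (h : k + (b + 1) ≤ n) :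
    X.δ 0 (interval X k (b + 1) h x) = interval X (k + 1) b (by omega) x := by
  have e : SimplexCategory.δ 0 ≫ SimplexCategory.subinterval k (b + 1) h =
      SimplexCategory.subinterval (k + 1) b (by omega) := by
    refine simplexHom_ext fun t => ?_
    simp only [SimplexCategory.comp_toOrderHom, OrderHom.comp_coe, Function.comp_apply]
    rw [subinterval_toOrderHom_val, subinterval_toOrderHom_val, δ_toOrderHom_val]
    simp only [cofaceNat, Fin.val_zero, Nat.not_lt_zero, if_false]
    omega
  unfold interval SimplicialObject.δ
  rw [← CategoryTheory.comp_apply, ← X.map_comp, ← op_comp, e]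

theorem interval_zero_δ_last {n : ℕ} (x : Simp X (n + 1)) (b : ℕ) (h : b ≤ n) :
    interval X 0 b (by omega) (X.δ (Fin.last (n + 1)) x) = interval X 0 b (by omega) x := by
  have e : SimplexCategory.subinterval 0 b (by omega) ≫ SimplexCategory.δ (Fin.last (n + 1)) =
      SimplexCategory.subinterval 0 b (by omega) := by
    refine simplexHom_ext fun t => ?_
    simp only [SimplexCategory.comp_toOrderHom, OrderHom.comp_coe, Function.comp_apply]
    rw [δ_toOrderHom_val, subinterval_toOrderHom_val, subinterval_toOrderHom_val]
    simp only [cofaceNat, Fin.val_last]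
    rw [if_pos (by omega)]
  unfold interval SimplicialObject.δ
  rw [← CategoryTheory.comp_apply, ← X.map_comp, ← op_comp, e]

end Interval

section GMap

variable {G : SimplicialObject GrpCat.{u}}

theorem G_map_comp {Δ Δ' Δ'' : SimplexCategory} (θ : Δ ⟶ Δ') (φ : Δ' ⟶ Δ'') (g : G.obj (op Δ'')) :
    G.map (θ ≫ φ).op g = G.map θ.op (G.map φ.op g) := by
  rw [op_comp, G.map_comp]
  rfl

theorem G_map_of_cofaceNat {d a : ℕ} {φ : SimplexCategory.mk d ⟶ SimplexCategory.mk (a + 1)}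
    {θ : SimplexCategory.mk d ⟶ SimplexCategory.mk a} (j : Fin (a + 2))
    (h : ∀ t, (φ.toOrderHom t : ℕ) = cofaceNat j (θ.toOrderHom t)) (g : GSimp G (a + 1)) :
    G.map φ.op g = G.map θ.op (G.δ j g) := by
  have : φ = θ ≫ SimplexCategory.δ j := simplexHom_ext fun t => by
    rw [h]
    exact (δ_toOrderHom_val _ _).symm
  rw [this, G_map_comp]
  rfl

theorem G_map_σ_of_codegenNat {d a : ℕ} {φ : SimplexCategory.mk d ⟶ SimplexCategory.mk a}
    {θ : SimplexCategory.mk d ⟶ SimplexCategory.mk (a + 1)} (j : Fin (a + 1))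
    (h : ∀ t, (φ.toOrderHom t : ℕ) = codegenNat j (θ.toOrderHom t)) (g : GSimp G a) :
    G.map θ.op (G.σ j g) = G.map φ.op g := by
  have : φ = θ ≫ SimplexCategory.σ j := simplexHom_ext fun t => by
    rw [h]
    exact (σ_toOrderHom_val _ _).symm
  rw [this, G_map_comp]
  rfl

/-- Twisting functions are compatible with front faces, since only iterated last faces occur. -/
theorem TwistingFunction.map_front {X : SSet.{u}} (τ : TwistingFunction X G) {l : ℕ} (r : ℕ)
    (y : Simp X (l + r + 1)) :
    G.map (SimplexCategory.subinterval 0 l (n := l + r) (by omega)).op (τ.toFun y) =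
      τ.toFun (interval X 0 (l + 1) (by omega) y) := by
  induction r with
  | zero =>
    have e₁ : SimplexCategory.subinterval 0 l (n := l) (by omega) = 𝟙 _ :=
      simplexHom_ext fun t => rfl
    have e₂ : SimplexCategory.subinterval 0 (l + 1) (n := l + 1) (by omega) = 𝟙 _ :=
      simplexHom_ext fun t => rfl
    unfold interval
    erw [e₁, e₂]
    simp
  | succ r ih =>
    have e := ih (X.δ (Fin.last (l + r + 2)) y)
    erw [interval_zero_δ_last X y (l + 1) (by omega)] at e
    rw [← e]
    have := τ.δ_succ (n := l + r) y (Fin.last _)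
    erw [← this]
    refine G_map_of_cofaceNat (Fin.last (l + r + 1)) (fun t => ?_) _
    rw [subinterval_toOrderHom_val, subinterval_toOrderHom_val, cofaceNat, if_pos]
    simp
    omega

end GMap

/-! ### The value of a cell on a simplex of a cube -/

section CellValue

open CubeSimplex Vert

/-- The monotone map sending the vertex `t` to the number of consecutive coordinates of `u t`
which are equal to `1`, counting from the position `k` on. -/
def runHom {n d : ℕ} (u : CubeSimplex n d) (k a : ℕ) (h : k + a = n) :
    SimplexCategory.mk d ⟶ SimplexCategory.mk a :=
  SimplexCategory.mkHom ⟨fun t => ⟨firstZero (u t) k - k, by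
    have := firstZero_le (u t) (k := k) (by omega)
    omega⟩, fun s t hst => Nat.sub_le_sub_right (firstZero_mono (u.monotone hst) k) k⟩

theorem runHom_val {n d : ℕ} (u : CubeSimplex n d) (k a : ℕ) (h : k + a = n) (t : Fin (d + 1)) :
    ((runHom u k a h).toOrderHom t : ℕ) = firstZero (u t) k - k := rfl

variable {X : SSet.{u}} {G : SimplicialObject GrpCat.{u}} (τ : TwistingFunction X G)

/-- The `k`-th factor of the value of the cell `⟨x⟩` on the simplex `u` of the cube. -/
def cellFactor {n d : ℕ} (x : Simp X (n + 1)) (u : CubeSimplex n d) (k : ℕ) : GSimp G d :=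
  if h : k ≤ n then G.map (runHom u k (n - k) (by omega)).op
    (τ.toFun (interval X k (n - k + 1) (by omega) x))⁻¹ else 1

theorem cellFactor_eq {n d : ℕ} (x : Simp X (n + 1)) (u : CubeSimplex n d) (k a : ℕ)
    (h : k + a = n) : cellFactor τ x u k =
      G.map (runHom u k a h).op (τ.toFun (interval X k (a + 1) (by omega) x))⁻¹ := by
  obtain rfl : a = n - k := by omega
  exact dif_pos (by omega)

/-- The image of the simplex `[⟨x⟩, u]` in `G`. It is the product of the elements `τ(d₀ᵏ x)⁻¹`,
pulled back along the maps `runHom u k`. -/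
def cellValue {n d : ℕ} (x : Simp X (n + 1)) (u : CubeSimplex n d) : GSimp G d :=
  ((List.range (n + 1)).map (cellFactor τ x u)).prod

theorem cellValue_comp {n d e : ℕ} (x : Simp X (n + 1)) (u : CubeSimplex n d)
    (θ : SimplexCategory.mk e ⟶ SimplexCategory.mk d) :
    cellValue τ x (u.comp θ.toOrderHom) = G.map θ.op (cellValue τ x u) := by
  unfold cellValue
  rw [map_list_prod, List.map_map]
  congr 1
  refine List.map_congr_left fun k hk => ?_
  rw [List.mem_range] at hk
  obtain ⟨a, rfl⟩ := Nat.exists_eq_add_of_le (Nat.le_of_lt_succ hk)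
  rw [Function.comp_apply, cellFactor_eq τ _ _ k a rfl, cellFactor_eq τ _ _ k a rfl, ← G_map_comp]
  rfl

theorem prod_range_merge {M : Type*} [Monoid M] {n : ℕ} (F F' : ℕ → M) (i : ℕ) (hi : i ≤ n)
    (hlt : ∀ k < i, F k = F' k) (heq : F i * F (i + 1) = F' i)
    (hgt : ∀ k, i < k → k ≤ n → F (k + 1) = F' k) :
    ((List.range (n + 2)).map F).prod = ((List.range (n + 1)).map F').prod := by
  obtain ⟨m, rfl⟩ := Nat.exists_eq_add_of_le hi
  rw [show i + m + 2 = i + (m + 2) by omega, show i + m + 1 = i + (m + 1) by omega,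
    List.range_add (n := i), List.range_add (n := i), List.map_append, List.map_append,
    List.prod_append, List.prod_append, List.range_succ_eq_map, List.range_succ_eq_map]
  simp only [List.map_cons, List.prod_cons, List.map_map, Nat.add_zero]
  rw [← heq, mul_assoc]
  congr 1
  · congr 1
    exact List.map_congr_left fun k hk => hlt k (List.mem_range.1 hk)
  · congr 3
    refine List.map_congr_left fun k hk => ?_
    have := List.mem_range.1 hk
    simp only [Function.comp_apply]
    rw [← hgt _ (by omega) (by omega)]
    congr 1

theorem prod_range_skip {M : Type*} [Monoid M] {n : ℕ} (F F' : ℕ → M) (p : ℕ) (hp : p ≤ n)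
    (hlt : ∀ k < p, F k = F' k) (heq : F p = 1) (hgt : ∀ k, p ≤ k → k < n → F (k + 1) = F' k) :
    ((List.range (n + 1)).map F).prod = ((List.range n).map F').prod := by
  obtain ⟨m, rfl⟩ := Nat.exists_eq_add_of_le hp
  rw [show p + m + 1 = p + (m + 1) by omega, List.range_add (n := p), List.range_add (n := p),
    List.map_append, List.map_append, List.prod_append, List.prod_append, List.range_succ_eq_map]
  simp only [List.map_cons, List.prod_cons, List.map_map, Nat.add_zero]
  rw [heq, one_mul]
  congr 2
  · exact List.map_congr_left fun k hk => hlt k (List.mem_range.1 hk)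
  · refine List.map_congr_left fun k hk => ?_
    have := List.mem_range.1 hk
    simp only [Function.comp_apply]
    rw [← hgt _ (by omega) (by omega)]
    congr 1

/-- The relation `d¹ᵢ⟨x⟩ = ⟨dᵢx⟩`. The factors `k < i` and `k > i` of the left-hand side
correspond to single factors, while the factors `i` and `i + 1` combine
because of `d₀τ(y) = τ(d₀y)⁻¹τ(d₁y)`. -/
theorem cellValue_face_one {n d : ℕ} (x : Simp X (n + 2)) (i : Fin (n + 1)) (u : CubeSimplex n d) :
    cellValue τ x (push (CubeMap.coface true i) u) = cellValue τ (X.δ i.succ.castSucc x) u := by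
  have hi := i.2
  refine prod_range_merge _ _ i (by omega) (fun k hk => ?_) ?_ fun k hk hk' => ?_
  · obtain ⟨a, ha⟩ := Nat.exists_eq_add_of_le (show k ≤ n by omega)
    rw [cellFactor_eq τ _ _ k (a + 1) (by omega), cellFactor_eq τ _ _ k a ha.symm,
      interval_δ_of_le X x _ k (a + 1) (by simp; omega) (by omega),
      G_map_of_cofaceNat (⟨i - k, by omega⟩ : Fin (a + 2)) (θ := runHom u k a ha.symm) fun t => ?_]
    · have e := τ.δ_succ (n := a) (interval X k (a + 2) (by omega) x) ⟨i - k - 1, by omega⟩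
      have e₁ : (⟨i - k, by omega⟩ : Fin (a + 2)) = (⟨i - k - 1, by omega⟩ : Fin (a + 1)).succ := by
        ext; simp; omega
      have e₂ : (⟨i.succ.castSucc - k, by simp; omega⟩ : Fin (a + 3)) =
          (⟨i - k - 1, by omega⟩ : Fin (a + 1)).succ.succ := by
        ext; simp; omega
      rw [e₂, ← e, e₁, map_inv]
    · rw [runHom_val, runHom_val]
      have := firstZero_cofaceFun_true i (u t) hk.le
      change firstZero (cofaceFun true i (u t)) k - k = _
      rw [this]
      have := le_firstZero (u t) k
      unfold cofaceNat
      dsimp only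
      split_ifs <;> omega
  · obtain ⟨a, ha⟩ := Nat.exists_eq_add_of_le (show (i : ℕ) ≤ n by omega)
    rw [cellFactor_eq τ _ _ i (a + 1) (by omega), cellFactor_eq τ _ _ i a ha.symm,
      cellFactor_eq τ _ _ (i + 1) a (by omega),
      interval_δ_of_le X x _ i (a + 1) (by simp) (by omega),
      G_map_of_cofaceNat (0 : Fin (a + 2)) (θ := runHom u i a ha.symm) fun t => ?_,
      show runHom (push (CubeMap.coface true i) u) (i + 1) a (by omega) = runHom u i a ha.symm from
        simplexHom_ext fun t => ?_, ← map_mul]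
    · have e := τ.δ_zero (n := a) (interval X i (a + 2) (by omega) x)
      have e₂ : (⟨i.succ.castSucc - i, by simp⟩ : Fin (a + 3)) = 1 := by
        ext; simp
      rw [e₂, map_inv, e, δ_zero_interval]
      congr 1
      group
    · rw [runHom_val, runHom_val]
      -- The run from `i + 1` on is not affected by the inserted coordinate `i`.
      change firstZero (cofaceFun true i (u t)) (i + 1) - (i + 1) = _
      rw [firstZero_cofaceFun true i (u t) le_rfl]
      omega
    · rw [runHom_val, runHom_val]
      have := firstZero_cofaceFun_true i (u t) le_rfl
      change firstZero (cofaceFun true i (u t)) i - i = _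
      rw [this]
      have := le_firstZero (u t) i
      unfold cofaceNat
      rw [if_neg (by omega), if_neg (by simp)]
      omega
  · obtain ⟨a, ha⟩ := Nat.exists_eq_add_of_le (show k ≤ n by omega)
    rw [cellFactor_eq τ _ _ (k + 1) a (by omega), cellFactor_eq τ _ _ k a ha.symm,
      interval_δ_of_ge X x _ k (a + 1) (by simp; omega) (by omega),
      show runHom (push (CubeMap.coface true i) u) (k + 1) a (by omega) = runHom u k a ha.symm from
        simplexHom_ext fun t => ?_]
    rw [runHom_val, runHom_val]
    change firstZero (cofaceFun true i (u t)) (k + 1) - (k + 1) = _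
    rw [firstZero_cofaceFun true i (u t) hk.le]
    omega

/-- The simplex of a cube consisting of the first coordinates of a simplex. -/
def CubeSimplex.fst {k l d : ℕ} (u : CubeSimplex (k + l) d) : CubeSimplex k d :=
  ⟨fun t c => u t (Fin.castAdd l c), fun _ _ h _ => u.monotone h _⟩

/-- The simplex of a cube consisting of the last coordinates of a simplex. -/
def CubeSimplex.snd {k l d : ℕ} (u : CubeSimplex (k + l) d) : CubeSimplex l d :=
  ⟨fun t c => u t (Fin.natAdd k c), fun _ _ h _ => u.monotone h _⟩

theorem CubeSimplex.pair_fst_snd {k l d : ℕ} (u : CubeSimplex (k + l) d) :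
    pair u.fst u.snd = u := by
  ext t c
  refine Fin.addCases (fun c => ?_) (fun c => ?_) c
  · exact Fin.append_left _ _ c
  · exact Fin.append_right _ _ c

/-- The relation `d⁰ᵢ⟨x⟩ = ⟨x(0…i)⟩⟨x(i…n+1)⟩`. -/
theorem cellValue_face_zero {a b d : ℕ} (x : Simp X (a + b + 2)) (u : CubeSimplex (a + b) d) :
    cellValue τ (n := a + b + 1) x
        (push (CubeMap.coface (n := a + b) false ⟨a, by omega⟩) u) =
      cellValue τ (interval X 0 (a + 1) (by omega) x) u.fst *
        cellValue τ (interval X (a + 1) (b + 1) (by omega) x) u.snd := by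
  unfold cellValue
  rw [show List.range (a + b + 1 + 1) = List.range ((a + 1) + (b + 1)) by congr 1; omega,
    List.range_add (n := a + 1),
    List.map_append, List.prod_append, List.map_map]
  congr 2
  · refine List.map_congr_left fun k hk => ?_
    rw [List.mem_range] at hk
    obtain ⟨c, rfl⟩ := Nat.exists_eq_add_of_le (Nat.le_of_lt_succ hk)
    rw [cellFactor_eq τ _ _ k (c + (b + 1)) (by omega), cellFactor_eq τ _ _ k c rfl,
      interval_interval]
    have e := τ.map_front (l := c) (b + 1) (interval X k (c + (b + 1) + 1) (by omega) x)
    rw [interval_interval] at e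
    have e' : interval X (0 + k) (c + 1) (by omega) x =
        interval X (k + 0) (c + 1) (by omega) x := by
      congr 1
      omega
    rw [e', ← e, ← map_inv, ← G_map_comp]
    congr 3
    refine congrArg Quiver.Hom.op (simplexHom_ext fun t => ?_)
    change firstZero (cofaceFun false ⟨k + c, by omega⟩ (u t)) k - k = _
    rw [firstZero_cofaceFun_false_of_le _ (by omega)]
    rfl
  · refine List.map_congr_left fun k hk => ?_
    rw [List.mem_range] at hk
    obtain ⟨c, rfl⟩ := Nat.exists_eq_add_of_le (Nat.le_of_lt_succ hk)
    rw [Function.comp_apply, cellFactor_eq τ _ _ (a + 1 + k) c (by omega),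
      cellFactor_eq τ _ _ k c rfl, interval_interval]
    congr 3
    refine congrArg Quiver.Hom.op (simplexHom_ext fun t => ?_)
    change firstZero (cofaceFun false ⟨a, by omega⟩ (u t)) (a + 1 + k) - (a + 1 + k) = _
    rw [show a + 1 + k = a + k + 1 by omega, firstZero_cofaceFun _ _ _ (by simp), firstZero_natAdd]
    change _ = firstZero (fun c => u t (Fin.natAdd a c)) k - k
    omega

/-- The value of a degenerate cell `⟨sₚx⟩`, if the first zeros of the two simplices correspond
to each other as under the degeneracy operator `sₚ`. -/
theorem cellValue_σ {n d : ℕ} (x : Simp X (n + 1)) (p : Fin (n + 2)) (u : CubeSimplex (n + 1) d)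
    (v : CubeSimplex n d)
    (hlt : ∀ k < (p : ℕ), ∀ t, firstZero (v t) k = codegenNat (p - 1) (firstZero (u t) k))
    (hge : ∀ k, (p : ℕ) ≤ k → ∀ t, firstZero (v t) k = firstZero (u t) (k + 1) - 1) :
    cellValue τ (X.σ p x) u = cellValue τ x v := by
  have hp := p.2
  refine prod_range_skip _ _ p (by omega) (fun k hk => ?_) ?_ fun k hk hk' => ?_
  · obtain ⟨a, ha⟩ := Nat.exists_eq_add_of_le (show k ≤ n by omega)
    have e₁ : (⟨p - k, by omega⟩ : Fin (a + 2)) = (⟨p - k - 1, by omega⟩ : Fin (a + 1)).succ := by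
      ext; simp; omega
    rw [cellFactor_eq τ _ _ k (a + 1) (by omega), cellFactor_eq τ _ _ k a ha.symm,
      interval_σ_of_lt X x p k (a + 1) hk.le (by omega), e₁, ← τ.σ_apply, ← map_inv]
    refine G_map_σ_of_codegenNat _ (fun t => ?_) _
    rw [runHom_val, runHom_val, hlt k hk]
    have := le_firstZero (u t) k
    unfold codegenNat
    dsimp only
    split_ifs <;> omega
  · obtain ⟨a, ha⟩ := Nat.exists_eq_add_of_le (show (p : ℕ) ≤ n + 1 by omega)
    rw [cellFactor_eq τ _ _ p a (by omega), interval_σ_of_lt X x p p a le_rfl (by omega),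
      show (⟨p - p, by omega⟩ : Fin (a + 1)) = 0 by ext; simp, τ.map_σ_zero, inv_one, map_one]
  · obtain ⟨a, ha⟩ := Nat.exists_eq_add_of_le (show k ≤ n by omega)
    rw [cellFactor_eq τ _ _ (k + 1) a (by omega), cellFactor_eq τ _ _ k a ha.symm,
      interval_succ_σ X x p (k + 1) (a + 1) (by omega) (by omega)]
    congr 3
    refine congrArg Quiver.Hom.op (simplexHom_ext fun t => ?_)
    rw [runHom_val, runHom_val, hge k hk]
    omega

theorem cellValue_conn {n d : ℕ} (x : Simp X (n + 2)) (i : Fin (n + 1))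
    (u : CubeSimplex (n + 2) d) :
    cellValue τ (X.σ i.succ.castSucc x) u = cellValue τ x (push (CubeMap.coconn i) u) := by
  refine cellValue_σ τ x _ u _ (fun k hk t => ?_) fun k hk t => ?_
  · simp only [Fin.val_castSucc, Fin.val_succ] at hk
    exact firstZero_coconnFun i (u t) (by omega)
  · simp only [Fin.val_castSucc, Fin.val_succ] at hk
    exact firstZero_coconnFun_of_lt i (u t) (by omega)

theorem cellValue_degen_first {n d : ℕ} (x : Simp X (n + 1)) (u : CubeSimplex (n + 1) d) :
    cellValue τ (X.σ 0 x) u = cellValue τ x (push (CubeMap.codegen 0) u) :=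
  cellValue_σ τ x _ u _ (fun _ hk => absurd hk (Nat.not_lt_zero _)) fun _ hk t =>
    firstZero_codegenFun 0 (u t) hk

theorem cellValue_degen_last {n d : ℕ} (x : Simp X (n + 1)) (u : CubeSimplex (n + 1) d) :
    cellValue τ (X.σ (Fin.last (n + 1)) x) u =
      cellValue τ x (push (CubeMap.codegen (Fin.last n)) u) := by
  refine cellValue_σ τ x _ u _ (fun k hk t => ?_) fun k hk t => ?_
  · exact firstZero_codegenFun_last (u t) (Nat.le_of_lt_succ hk)
  · exact firstZero_codegenFun (Fin.last n) (u t) ((Nat.le_succ n).trans hk)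

theorem cellValue_unit (hX : IsOneReduced X) {d : ℕ} (x : Simp X 1) (u : CubeSimplex 0 d) :
    cellValue τ x u = 1 := by
  -- The only `1`-simplex of `X` is degenerate, so that `τ(s₀y) = 1` applies.
  obtain ⟨y⟩ := hX.nonempty_zero
  obtain rfl : X.σ 0 y = x := hX.subsingleton_one.elim _ _
  refine List.prod_eq_one fun g hg => ?_
  simp only [Nat.zero_add, List.range_one, List.map_cons, List.map_nil, List.mem_singleton] at hg
  rw [hg, cellFactor_eq τ _ _ 0 0 rfl, interval_σ_of_lt X y 0 0 0 le_rfl rfl]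
  erw [τ.map_σ_zero]
  rw [inv_one, map_one]

end CellValue

/-! ### The morphism of simplicial monoids -/

section WordValue

open CubeSimplex

variable {X : SSet.{u}} {G : SimplicialObject GrpCat.{u}} (τ : TwistingFunction X G)

/-- The image in `G` of the simplex `[⟨x₁, …, x_k⟩, u]`: the product of the values of the letters on
the corresponding blocks of coordinates. -/
def wordValue {d : ℕ} : (w : Word X) → CubeSimplex w.dim d → GSimp G d
  | [], _ => 1
  | x :: w, u => cellValue τ x.2 (CubeSimplex.fst (l := Word.dim w) u) *
      wordValue w (CubeSimplex.snd (k := x.1) u)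

theorem wordValue_singleton {n d : ℕ} (x : Simp X (n + 1)) (u : CubeSimplex n d) :
    wordValue τ [⟨n, x⟩] u = cellValue τ x u := mul_one _

theorem wordValue_pair {a b d : ℕ} (x : Simp X (a + 1)) (y : Simp X (b + 1))
    (u : CubeSimplex (a + b) d) :
    wordValue τ [⟨a, x⟩, ⟨b, y⟩] u = cellValue τ x u.fst * cellValue τ y u.snd :=
  congrArg _ (mul_one _)

theorem wordValue_append {d : ℕ} : ∀ (w w' : Word X) (v : CubeSimplex w.dim d)
    (v' : CubeSimplex w'.dim d),
    wordValue τ (w ++ w') (push (CubeMap.cast (Word.dim_append w w').symm) (pair v v')) =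
      wordValue τ w v * wordValue τ w' v'
  | [], w', v, v' => by
    refine Eq.trans ?_ (one_mul _).symm
    congr 1
    ext t c
    refine (congrArg (Fin.append (v t) (v' t)) ?_).trans (Fin.append_right _ _ c)
    ext
    simp only [Word.dim, Fin.val_natAdd, Nat.zero_add]
    rfl
  | x :: w, w', v, v' => by
    have ih := wordValue_append w w' (CubeSimplex.snd (k := x.1) v) v'
    change _ = cellValue τ x.2 _ * wordValue τ w _ * wordValue τ w' v'
    rw [mul_assoc, ← ih]
    change cellValue τ x.2 _ * wordValue τ (w ++ w') _ = _
    congr 2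
    · ext t c
      exact Fin.append_left _ _ (Fin.castAdd (Word.dim w) c)
    · ext t c
      obtain ⟨c, rfl⟩ := (finCongr (Word.dim_append w w').symm).surjective c
      refine Fin.addCases (fun c => ?_) (fun c => ?_) c
      · refine Eq.trans ?_ (Fin.append_left _ _ c).symm
        exact Fin.append_left (v t) (v' t) (Fin.natAdd x.1 c)
      · refine Eq.trans ?_ (Fin.append_right _ _ c).symm
        refine (congrArg (Fin.append (v t) (v' t)) ?_).trans (Fin.append_right _ _ c)
        ext
        simp only [Word.dim, Fin.val_natAdd, Nat.add_assoc]
        rfl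

theorem push_cast_pair {m n d k : ℕ} (h : k = m + n) (u : CubeSimplex k d) :
    ∃ (v : CubeSimplex m d) (v' : CubeSimplex n d), u = push (CubeMap.cast h.symm) (pair v v') := by
  subst h
  exact ⟨u.fst, u.snd, (pair_fst_snd u).symm⟩

/-- The values of words respect the defining relations of the cubical cobar construction. -/
theorem wordValue_push (hX : IsOneReduced X) {w' w : Word X} {g : CubeMap w'.dim w.dim}
    (h : WordMap w' w g) {d : ℕ} (u : CubeSimplex w'.dim d) :
    wordValue τ w (push g u) = wordValue τ w' u := by
  induction h with
  | refl w => rfl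
  | @append w₁ w₁' w₂ w₂' f₁ f₂ _ _ ih₁ ih₂ =>
    obtain ⟨v, v', rfl⟩ := push_cast_pair (Word.dim_append w₁' w₂') u
    rw [wordValue_append, ← ih₁, ← ih₂, ← wordValue_append]
    congr 1
    rw [← push_pair]
    rfl
  | face_one x i =>
    exact (wordValue_singleton τ _ _).trans ((cellValue_face_one τ x i u).trans
      (wordValue_singleton τ _ _).symm)
  | face_zero x =>
    exact (wordValue_singleton τ _ _).trans ((cellValue_face_zero τ x u).trans
      (wordValue_pair τ _ _ u).symm)
  | conn x i =>
    exact (wordValue_singleton τ _ _).trans ((cellValue_conn τ x i u).symm.trans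
      (wordValue_singleton τ _ _).symm)
  | degen_first x =>
    exact (wordValue_singleton τ _ _).trans ((cellValue_degen_first τ x u).symm.trans
      (wordValue_singleton τ _ _).symm)
  | degen_last x =>
    exact (wordValue_singleton τ _ _).trans ((cellValue_degen_last τ x u).symm.trans
      (wordValue_singleton τ _ _).symm)
  | unit x => exact ((wordValue_singleton τ x u).trans (cellValue_unit τ hX x u)).symm

theorem wordValue_comp {d e : ℕ} (θ : SimplexCategory.mk e ⟶ SimplexCategory.mk d) :
    ∀ (w : Word X) (u : CubeSimplex w.dim d),
      wordValue τ w (u.comp θ.toOrderHom) = G.map θ.op (wordValue τ w u)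
  | [], _ => (map_one _).symm
  | x :: w, u => by
    refine Eq.trans ?_ (map_mul (G.map θ.op).hom _ _).symm
    exact congrArg₂ _ (cellValue_comp τ x.2 (CubeSimplex.fst (l := Word.dim w) u) θ)
      (wordValue_comp θ w (CubeSimplex.snd (k := x.1) u))

/-- The map `[f^* ⟨w⟩, u] ↦ wordValue w (f_* u)` on the simplices of a fixed dimension. -/
def triangValue (hX : IsOneReduced X) (d : ℕ) :
    Triang (cubicalCobar X).toCubicalSet d → GSimp G d :=
  Quot.lift
    (fun s => Quot.lift (fun y : Σ w : Word X, CubeMap s.1 w.dim =>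
        wordValue τ y.1 (push y.2 s.2.2)) (by
      rintro _ _ ⟨h, f⟩
      exact wordValue_push τ hX h (push f s.2.2)) s.2.1) (by
    rintro _ _ ⟨f, y, u⟩
    induction y using Quot.ind
    rfl)

theorem triangValue_mul (hX : IsOneReduced X) {d : ℕ}
    (a b : Triang (cubicalCobar X).toCubicalSet d) :
    triangValue τ hX d (a * b) = triangValue τ hX d a * triangValue τ hX d b := by
  obtain ⟨k, y, v⟩ := a
  obtain ⟨l, z, v'⟩ := b
  obtain ⟨w, f⟩ := y
  obtain ⟨w', f'⟩ := z
  refine Eq.trans ?_ (wordValue_append τ w w' (push f v) (push f' v'))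
  rw [← push_pair]
  rfl

theorem triangValue_map (hX : IsOneReduced X) {d e : ℕ}
    (θ : SimplexCategory.mk e ⟶ SimplexCategory.mk d)
    (a : Triang (cubicalCobar X).toCubicalSet d) :
    triangValue τ hX e (Triang.map θ.toOrderHom a) = G.map θ.op (triangValue τ hX d a) := by
  obtain ⟨k, y, v⟩ := a
  obtain ⟨w, f⟩ := y
  exact wordValue_comp τ θ w (push f v)

/-- The morphism of simplicial monoids from the triangulated cubical cobar construction to `G`
determined by a twisting function. -/
def szMorphism (hX : IsOneReduced X) :
    triangMonoid (cubicalCobar X) ⟶ G ⋙ forget₂ GrpCat MonCat where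
  app Δ := MonCat.ofHom
    { toFun := triangValue τ hX Δ.unop.len
      map_one' := rfl
      map_mul' := triangValue_mul τ hX }
  naturality Δ Δ' θ := by
    ext a
    exact triangValue_map τ hX θ.unop a

theorem szMorphism_cobarCell (hX : IsOneReduced X) {n d : ℕ} (x : Simp X (n + 1))
    (u : CubeSimplex n d) :
    (szMorphism τ hX).app (op (SimplexCategory.mk d)) (Triang.mk (cobarCell x) u) =
      cellValue τ x u := wordValue_singleton τ x u

end WordValue

/-! ### Permutations, Szczarba indices and simplices of cubes -/

section Lehmer

open CubeSimplex Vert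

theorem Vert.firstZero_congr {m n : ℕ} {s : Vert m} {t : Vert n} (h : ∀ j, extend s j = extend t j)
    (k : ℕ) : firstZero s k = firstZero t k :=
  firstZero_eq (le_firstZero t k) (by rw [h, extend_firstZero]) fun j hj hj' => by
    rw [h, extend_of_lt_firstZero t hj hj']

/-- The `t`-th vertex of the path in the cube encoded by a sequence `l = (i₁, …, iₙ)`: the
coordinate `i₁` becomes `1` first, and the remaining ones follow the path encoded by
`(i₂, …, iₙ)`. -/
def codeVert : (l : List ℕ) → ℕ → Vert l.length
  | [], _ => fun _ => false
  | _ :: _, 0 => fun _ => false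
  | i :: l, t + 1 => cofaceFun true (Fin.ofNat (l.length + 1) i) (codeVert l t)

/-- Szczarba's recursion for the operators `D_{i,k}` is the recursion for the first zeros along the
path encoded by `i`. -/
theorem szMap_eq_firstZero : ∀ (l : List ℕ) (k t : ℕ), SzValid l → k ≤ l.length → t ≤ l.length →
    szMap l k t = firstZero (codeVert l t) k - k
  | [], k, t, _, hk, ht => by
    have := firstZero_le (codeVert [] t) hk
    simp only [szMap, List.length_nil] at *
    omega
  | i :: l, k, 0, _, hk, _ => by
    have : firstZero (codeVert (i :: l) 0) k = k :=
      firstZero_eq le_rfl (by simp [codeVert, Vert.extend]) fun j hj hj' => by omega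
    rw [szMap_zero, this, Nat.sub_self]
  | i :: l, k, t + 1, ⟨hi, hl⟩, hk, ht => by
    have hv : (Fin.ofNat (l.length + 1) i : ℕ) = i := Nat.mod_eq_of_lt (Nat.lt_succ_of_le hi)
    simp only [List.length_cons] at hk ht
    simp only [szMap, derive, codeVert, Nat.add_sub_cancel]
    split_ifs with h₁ h₂
    · have h := le_firstZero (codeVert l t) k
      have e := firstZero_cofaceFun_true (Fin.ofNat (l.length + 1) i) (codeVert l t)
        (k := k) (by omega)
      rw [szMap_eq_firstZero l k t hl (by omega) (by omega)]
      refine Eq.trans ?_ (congrArg (· - k) e.symm)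
      simp only [cofaceNat, hv]
      split_ifs <;> omega
    · have h := le_firstZero (codeVert l t) k
      have e := firstZero_cofaceFun_true (Fin.ofNat (l.length + 1) i) (codeVert l t)
        (k := k) (by omega)
      rw [szMap_eq_firstZero l k t hl (by omega) (by omega)]
      refine Eq.trans ?_ (congrArg (· - k) e.symm)
      simp only [cofaceNat, hv]
      split_ifs <;> omega
    · obtain ⟨k, rfl⟩ : ∃ k', k = k' + 1 := ⟨k - 1, by omega⟩
      have h := le_firstZero (codeVert l t) k
      have e := firstZero_cofaceFun true (Fin.ofNat (l.length + 1) i) (codeVert l t)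
        (k := k) (by omega)
      rw [Nat.add_sub_cancel, szMap_eq_firstZero l k t hl (by omega) (by omega)]
      refine Eq.trans ?_ (congrArg (· - (k + 1)) e.symm)
      omega

/-- Removing the first value from a permutation. -/
theorem exists_perm_succAbove {n : ℕ} (π : Equiv.Perm (Fin (n + 1))) :
    ∃ π' : Equiv.Perm (Fin n), ∀ j, π j.succ = (π 0).succAbove (π' j) := by
  have h : ∀ j : Fin n, ∃ c, (π 0).succAbove c = π j.succ := fun j =>
    Fin.exists_succAbove_eq fun h => Fin.succ_ne_zero j (π.injective h)
  choose f hf using h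
  have hinj : Function.Injective f := fun a b hab =>
    Fin.succ_injective _ (π.injective (by rw [← hf, ← hf, hab]))
  exact ⟨Equiv.ofBijective f (Finite.injective_iff_bijective.1 hinj), fun j => (hf j).symm⟩

theorem toList_szIndexOfPerm_succ {n : ℕ} {π : Equiv.Perm (Fin (n + 1))} {π' : Equiv.Perm (Fin n)}
    (h : ∀ j, π j.succ = (π 0).succAbove (π' j)) :
    (szIndexOfPerm π).toList = (π 0 : ℕ) :: (szIndexOfPerm π').toList := by
  unfold SzIndex.toList
  rw [List.ofFn_succ]
  congr 1
  · have : (Finset.univ.filter fun j => j ≤ 0 ∧ π j ≤ π 0) = {0} := by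
      ext j
      simp only [Finset.mem_filter, Finset.mem_univ, true_and, Finset.mem_singleton]
      exact ⟨fun hj => Fin.le_zero_iff.1 hj.1, fun hj => hj ▸ ⟨le_rfl, le_rfl⟩⟩
    simp only [szIndexOfPerm, this, Finset.card_singleton, Nat.add_sub_cancel]
  · congr 1
    funext k
    simp only [szIndexOfPerm]
    rw [Fin.card_filter_univ_succ]
    simp only [Fin.zero_le, true_and, Fin.succ_le_succ_iff, h,
      (Fin.strictMono_succAbove (π 0)).le_iff_le]
    simp only [Fin.le_def]
    have hv : ((π 0).succAbove (π' k) : ℕ) =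
        if (π' k : ℕ) < π 0 then (π' k : ℕ) else π' k + 1 := by
      simp only [Fin.succAbove, Fin.lt_def, Fin.val_castSucc]
      split_ifs <;> rfl
    rw [hv]
    split_ifs <;> omega

theorem ofPerm_succ {n : ℕ} {π : Equiv.Perm (Fin (n + 1))} {π' : Equiv.Perm (Fin n)}
    (h : ∀ j, π j.succ = (π 0).succAbove (π' j)) (t : Fin (n + 1)) :
    ofPerm π t.succ = cofaceFun true (π 0) (ofPerm π' t) := by
  funext c
  rcases Fin.eq_self_or_eq_succAbove (π 0) c with rfl | ⟨c, rfl⟩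
  · simp [ofPerm_apply, cofaceFun]
  · obtain ⟨j, rfl⟩ := π'.surjective c
    rw [cofaceFun, Fin.insertNth_apply_succAbove, ← h, ofPerm_apply, ofPerm_apply]
    simp

theorem extend_codeVert_szIndexOfPerm : ∀ {n : ℕ} (π : Equiv.Perm (Fin n)) (t : Fin (n + 1)) (j : ℕ),
    extend (codeVert (szIndexOfPerm π).toList t) j = extend (ofPerm π t) j
  | 0, π, t, j => by
    rw [extend_of_le _ (by rw [SzIndex.length_toList]; omega), extend_of_le _ (by omega)]
  | n + 1, π, t, j => by
    obtain ⟨π', h⟩ := exists_perm_succAbove π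
    rw [toList_szIndexOfPerm_succ h]
    refine Fin.cases ?_ (fun t => ?_) t
    · have e : ofPerm π 0 = fun _ => false := funext fun c => by simp [ofPerm_apply]
      rw [e]
      simp [codeVert, Vert.extend]
    · rw [ofPerm_succ h, Fin.val_succ]
      have hv : (Fin.ofNat ((szIndexOfPerm π').toList.length + 1) (π 0) : ℕ) = π 0 :=
        Nat.mod_eq_of_lt (by rw [SzIndex.length_toList]; omega)
      refine (extend_cofaceFun _ _ _ _).trans ?_
      rw [extend_cofaceFun, hv, extend_codeVert_szIndexOfPerm, extend_codeVert_szIndexOfPerm]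

theorem szHom_szIndexOfPerm {n : ℕ} (π : Equiv.Perm (Fin n)) (k a : ℕ) (h : k + a = n) :
    szHom (szIndexOfPerm π) k a h = runHom (ofPerm π) k a h := by
  refine simplexHom_ext fun t => ?_
  have hl := (szIndexOfPerm π).length_toList
  refine (szMap_eq_firstZero _ k t (szIndexOfPerm π).valid (by omega) (by omega)).trans ?_
  rw [runHom_val, firstZero_congr (extend_codeVert_szIndexOfPerm π t)]

theorem cellValue_ofPerm {X : SSet.{u}} {G : SimplicialObject GrpCat.{u}} (τ : TwistingFunction X G)
    {n : ℕ} (x : Simp X (n + 1)) (π : Equiv.Perm (Fin n)) :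
    cellValue τ x (ofPerm π) = τ.szPerm π x := by
  unfold TwistingFunction.szPerm TwistingFunction.sz cellValue
  rw [List.ofFn_eq_map, ← List.map_coe_finRange_eq_range, List.map_map]
  congr 1
  refine List.map_congr_left fun k _ => ?_
  rw [Function.comp_apply, cellFactor_eq τ _ _ k (n - k) (by omega), TwistingFunction.szTerm,
    szHom_szIndexOfPerm]

theorem szIndexOfPerm_bijective (n : ℕ) : Function.Bijective (szIndexOfPerm (n := n)) := by
  refine (Fintype.bijective_iff_injective_and_card _).2 ⟨fun π ρ h => ?_, ?_⟩
  · have key : ∀ (c : Fin n) (t : Fin (n + 1)), (π.symm c : ℕ) < t ↔ (ρ.symm c : ℕ) < t := by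
      intro c t
      have := (extend_codeVert_szIndexOfPerm π t c).symm.trans
        (h ▸ extend_codeVert_szIndexOfPerm ρ t c)
      rwa [extend_val, extend_val, ofPerm_apply, ofPerm_apply, decide_eq_decide] at this
    refine Equiv.symm_bijective.injective (Equiv.ext fun c => Fin.ext ?_)
    have h₁ := key c (π.symm c).succ
    have h₂ := key c (ρ.symm c).succ
    simp only [Fin.val_succ] at h₁ h₂
    omega
  · rw [Fintype.card_perm, Fintype.card_fin, Fintype.card_pi]
    simp only [Fintype.card_fin]
    rw [Fin.prod_univ_eq_prod_range (fun k => n - k), ← Nat.descFactorial_eq_prod_range,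
      Nat.descFactorial_self]

/-- The entries of the sequence belonging to `π` count the inversions of `π`. -/
theorem szIndexOfPerm_val {n : ℕ} (π : Equiv.Perm (Fin n)) (k : Fin n) :
    (szIndexOfPerm π k : ℕ) = ((Finset.Ioi k).filter fun j => π j < π k).card := by
  have h₁ : (Finset.univ.filter fun j => π j ≤ π k).card = π k + 1 := by
    rw [← Fin.card_Iic (π k), ← Finset.card_map π.toEmbedding]
    congr 1
    ext c
    simp
  have h₂ := Finset.card_filter_add_card_filter_not (s := Finset.univ.filter fun j => π j ≤ π k)
    (fun j => j ≤ k)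
  rw [Finset.filter_filter, Finset.filter_filter, h₁] at h₂
  have h₃ : (Finset.univ.filter fun j => π j ≤ π k ∧ j ≤ k) =
      Finset.univ.filter fun j => j ≤ k ∧ π j ≤ π k := by
    simp only [and_comm]
  have h₄ : (Finset.univ.filter fun j => π j ≤ π k ∧ ¬ j ≤ k) =
      (Finset.Ioi k).filter fun j => π j < π k := by
    ext j
    simp only [Finset.mem_filter, Finset.mem_univ, true_and, Finset.mem_Ioi, not_le]
    refine ⟨fun h => ⟨h.2, lt_of_le_of_ne h.1 fun h' => ?_⟩, fun h => ⟨h.2.le, h.1⟩⟩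
    exact h.2.ne' (π.injective h')
  rw [h₃, h₄] at h₂
  simp only [szIndexOfPerm]
  omega

theorem sign_eq_neg_one_pow_deg {n : ℕ} (π : Equiv.Perm (Fin n)) :
    ((Equiv.Perm.sign π : ℤˣ) : ℤ) = (-1) ^ (szIndexOfPerm π).deg := by
  rw [Equiv.Perm.sign_eq_prod_prod_Ioi, SzIndex.deg, ← Finset.prod_pow_eq_pow_sum, Units.coe_prod]
  refine Finset.prod_congr rfl fun k _ => ?_
  rw [szIndexOfPerm_val, Units.coe_prod, ← Finset.prod_const, Finset.prod_filter]
  refine Finset.prod_congr rfl fun j hj => ?_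
  have : π k ≠ π j := fun h => (Finset.mem_Ioi.1 hj).ne (π.injective h)
  rcases lt_or_gt_of_ne this with h | h
  · simp [h, h.not_gt]
  · simp [h, h.not_gt]

/-- Every simplex of a cube is the image of a top-dimensional simplex `u_π` under a
simplicial operator: `π` sorts the coordinates by the time at which they become `1`. -/
theorem exists_ofPerm_comp {n d : ℕ} (v : CubeSimplex n d) :
    ∃ (π : Equiv.Perm (Fin n)) (θ : SimplexCategory.mk d ⟶ SimplexCategory.mk n),
      v = (ofPerm π).comp θ.toOrderHom := by
  -- The time at which the coordinate `c` becomes `1`; it is `d + 1` if this never happens.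
  let f : Fin n → ℕ := fun c => (Finset.univ.filter fun t => v t c = false).card
  have hf : ∀ c (t : Fin (d + 1)), v t c = true ↔ f c ≤ t := by
    intro c t
    constructor
    · intro h
      rw [← Fin.card_Iio t]
      refine Finset.card_le_card fun s hs => ?_
      simp only [Finset.mem_filter, Finset.mem_univ, true_and, Finset.mem_Iio] at hs ⊢
      by_contra! hst
      have := v.monotone hst c h
      simp [hs] at this
    · intro h
      by_contra hv
      rw [Bool.not_eq_true] at hv
      have : (Finset.Iic t).card ≤ f c := by
        refine Finset.card_le_card fun s hs => ?_
        simp only [Finset.mem_filter, Finset.mem_univ, true_and, Finset.mem_Iic] at hs ⊢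
        by_contra hvs
        rw [Bool.not_eq_false] at hvs
        have := v.monotone hs c hvs
        simp [hv] at this
      rw [Fin.card_Iic] at this
      omega
  let π := Tuple.sort f
  refine ⟨π, SimplexCategory.mkHom ⟨fun t => ⟨(Finset.univ.filter fun j => f (π j) ≤ t).card,
    Nat.lt_succ_of_le ((Finset.card_filter_le _ _).trans (by simp))⟩, fun s t hst =>
      Finset.card_le_card fun j hj => ?_⟩, ?_⟩
  · simp only [Finset.mem_filter, Finset.mem_univ, true_and] at hj ⊢
    exact hj.trans hst
  · ext t c
    obtain ⟨j, rfl⟩ := π.surjective c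
    have := Tuple.lt_card_le_iff_apply_le_of_monotone (f := f ∘ π) (a := (t : ℕ)) (j := j)
      (Tuple.monotone_sort f)
    rw [Bool.eq_iff_iff, hf]
    refine this.symm.trans ?_
    change _ ↔ ofPerm π _ (π j) = true
    rw [ofPerm_apply, decide_eq_true_iff, Equiv.symm_apply_apply]
    rfl

end Lehmer

/-! ### Uniqueness -/

section Uniqueness

open CubeSimplex

variable {X : SSet.{u}}

theorem Triang.mk_cobarCube {n d : ℕ} (w : Word X) (f : CubeMap n w.dim) (u : CubeSimplex n d) :
    Triang.mk (Y := (cubicalCobar X).toCubicalSet) (CobarCube.mk w f) u =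
      Triang.mk (Y := (cubicalCobar X).toCubicalSet) (CobarCube.mk w (CubeMap.id _)) (push f u) :=
  Triang.mk_map (Y := (cubicalCobar X).toCubicalSet) f (CobarCube.mk w (CubeMap.id _)) u

theorem Triang.mk_cons {d : ℕ} (x : Σ n : ℕ, Simp X (n + 1)) (w : Word X)
    (u : CubeSimplex (x.1 + Word.dim w) d) :
    Triang.mk (Y := (cubicalCobar X).toCubicalSet) (CobarCube.mk (x :: w) (CubeMap.id _)) u =
      Triang.mk (Y := (cubicalCobar X).toCubicalSet) (cobarCell x.2) u.fst *
        Triang.mk (Y := (cubicalCobar X).toCubicalSet) (CobarCube.mk w (CubeMap.id _)) u.snd := by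
  refine Eq.trans ?_ (Triang.mk_mul_mk (cubicalCobar X) (cobarCell x.2)
    (CobarCube.mk w (CubeMap.id _)) u.fst u.snd).symm
  refine Eq.trans ?_ (congrArg _ (pair_fst_snd u).symm)
  refine Eq.trans ?_ (Triang.mk_cobarCube (x :: w) _ u).symm
  congr 1
  ext t c
  symm
  change Fin.append (fun c => u t (Fin.castAdd (Word.dim w) c)) (fun c => u t (Fin.natAdd x.1 c)) c
    = u t c
  refine Fin.addCases (fun c => ?_) (fun c => ?_) c
  · exact Fin.append_left _ _ c
  · exact Fin.append_right _ _ c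

/-- Morphisms out of the triangulation of the cubical cobar construction are determined by their
values on the simplices `[⟨x⟩, u_π]`. -/
theorem triangMonoid_hom_ext {H : SimplicialObject MonCat.{u}}
    {f g : triangMonoid (cubicalCobar X) ⟶ H}
    (h : ∀ (n : ℕ) (x : Simp X (n + 1)) (π : Equiv.Perm (Fin n)),
      f.app (op (SimplexCategory.mk n)) (Triang.mk (cobarCell x) (ofPerm π)) =
        g.app (op (SimplexCategory.mk n)) (Triang.mk (cobarCell x) (ofPerm π))) : f = g := by
  have hcell : ∀ {n d : ℕ} (x : Simp X (n + 1)) (v : CubeSimplex n d),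
      f.app (op (SimplexCategory.mk d)) (Triang.mk (cobarCell x) v) =
        g.app (op (SimplexCategory.mk d)) (Triang.mk (cobarCell x) v) := by
    intro n d x v
    obtain ⟨π, θ, rfl⟩ := exists_ofPerm_comp v
    have hf := ConcreteCategory.congr_hom (f.naturality θ.op) (Triang.mk (cobarCell x) (ofPerm π))
    have hg := ConcreteCategory.congr_hom (g.naturality θ.op) (Triang.mk (cobarCell x) (ofPerm π))
    exact hf.trans ((congrArg _ (h n x π)).trans hg.symm)
  have hword : ∀ {d : ℕ} (w : Word X) (u : CubeSimplex w.dim d),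
      f.app (op (SimplexCategory.mk d)) (Triang.mk (CobarCube.mk w (CubeMap.id _)) u) =
        g.app (op (SimplexCategory.mk d)) (Triang.mk (CobarCube.mk w (CubeMap.id _)) u) := by
    intro d w
    induction w with
    | nil =>
      intro u
      have e : (Triang.mk (Y := (cubicalCobar X).toCubicalSet) (CobarCube.mk [] (CubeMap.id _)) u) =
          (1 : Triang (cubicalCobar X).toCubicalSet d) := by
        refine congrArg _ ?_
        ext t c
        exact c.elim0
      have hf := map_one (f.app (op (SimplexCategory.mk d))).hom
      have hg := map_one (g.app (op (SimplexCategory.mk d))).hom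
      exact (congrArg _ e).trans (hf.trans (hg.symm.trans (congrArg _ e.symm)))
    | cons x w ih =>
      intro u
      have e := Triang.mk_cons x w u
      have hf := map_mul (f.app (op (SimplexCategory.mk d))).hom
        (Triang.mk (Y := (cubicalCobar X).toCubicalSet) (cobarCell x.2)
          (CubeSimplex.fst (l := Word.dim w) u))
        (Triang.mk (Y := (cubicalCobar X).toCubicalSet) (CobarCube.mk w (CubeMap.id _))
          (CubeSimplex.snd (k := x.1) u))
      have hg := map_mul (g.app (op (SimplexCategory.mk d))).hom
        (Triang.mk (Y := (cubicalCobar X).toCubicalSet) (cobarCell x.2)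
          (CubeSimplex.fst (l := Word.dim w) u))
        (Triang.mk (Y := (cubicalCobar X).toCubicalSet) (CobarCube.mk w (CubeMap.id _))
          (CubeSimplex.snd (k := x.1) u))
      exact (congrArg _ e).trans (hf.trans ((congrArg₂ _ (hcell x.2 _) (ih _)).trans
        (hg.symm.trans (congrArg _ e.symm))))
  ext Δ a
  obtain ⟨n, y, u⟩ := a
  obtain ⟨w, φ⟩ := y
  have e := Triang.mk_cobarCube w φ u
  exact (congrArg _ e).trans ((hword w (push φ u)).trans (congrArg _ e.symm))

end Uniqueness

/-! ### Shuffles and permutations -/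

section Shuffle

open CubeSimplex

theorem card_filter_lt_orderEmbOfFin {n k : ℕ} (α : Finset (Fin n)) (h : α.card = k) (i : Fin k) :
    (α.filter fun a => a < α.orderEmbOfFin h i).card = i := by
  have e : (α.filter fun a : Fin n => a < α.orderEmbOfFin h i) =
      (Finset.Iio i).map (α.orderEmbOfFin h).toEmbedding := by
    ext a
    simp only [Finset.mem_filter, Finset.mem_map, Finset.mem_Iio]
    constructor
    · rintro ⟨ha, hlt⟩
      rw [← Finset.mem_coe, ← Finset.range_orderEmbOfFin α h] at ha
      obtain ⟨j, rfl⟩ := ha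
      exact ⟨j, (α.orderEmbOfFin h).lt_iff_lt.1 hlt, rfl⟩
    · rintro ⟨j, hj, rfl⟩
      exact ⟨Finset.orderEmbOfFin_mem _ _ _, (α.orderEmbOfFin h).lt_iff_lt.2 hj⟩
  rw [e, Finset.card_map, Fin.card_Iio]

theorem lt_degenHom_iff {n k : ℕ} (α : Finset (Fin n)) (h : α.card = k) (j : Fin k)
    (t : Fin (n + 1)) :
    (j : ℕ) < (degenHom α h).toOrderHom t ↔ (α.orderEmbOfFin h j : ℕ) < t := by
  change (j : ℕ) < (α.filter fun a : Fin n => (a : ℕ) < t).card ↔ _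
  have hj := card_filter_lt_orderEmbOfFin α h j
  constructor
  · intro hlt
    by_contra! hle
    rw [← hj] at hlt
    refine hlt.not_ge (Finset.card_le_card fun a ha => ?_)
    rw [Finset.mem_filter] at ha ⊢
    exact ⟨ha.1, Fin.lt_def.2 (ha.2.trans_le hle)⟩
  · intro hlt
    conv_lhs => rw [← hj]
    refine Finset.card_lt_card ⟨fun a ha => ?_, fun hs => ?_⟩
    · rw [Finset.mem_filter] at ha ⊢
      exact ⟨ha.1, (Fin.lt_def.1 ha.2).trans hlt⟩
    · have := hs (Finset.mem_filter.2 ⟨Finset.orderEmbOfFin_mem α h j, hlt⟩)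
      exact lt_irrefl _ (Finset.mem_filter.1 this).2

variable {k l : ℕ}

/-- The permutation whose restrictions to the positions `α` and to the complement of `α` are
`σ` and `ρ`, with values in the first `k` and in the last `l` elements, respectively. -/
def shufflePerm (α : Shuffle k l) (σ : Equiv.Perm (Fin k)) (ρ : Equiv.Perm (Fin l)) :
    Equiv.Perm (Fin (k + l)) :=
  ((finSumEquivOfFinset α.2 α.card_compl).symm.trans (Equiv.sumCongr σ ρ)).trans finSumFinEquiv

theorem shufflePerm_symm_castAdd (α : Shuffle k l) (σ : Equiv.Perm (Fin k))
    (ρ : Equiv.Perm (Fin l)) (c : Fin k) :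
    (shufflePerm α σ ρ).symm (Fin.castAdd l c) = α.1.orderEmbOfFin α.2 (σ.symm c) := by
  simp [shufflePerm]

theorem shufflePerm_symm_natAdd (α : Shuffle k l) (σ : Equiv.Perm (Fin k))
    (ρ : Equiv.Perm (Fin l)) (c : Fin l) :
    (shufflePerm α σ ρ).symm (Fin.natAdd k c) = α.1ᶜ.orderEmbOfFin α.card_compl (ρ.symm c) := by
  simp [shufflePerm]

/-- The two components of the simplex `u_π` of the cube `I^k × I^l`, where `π` comes from a
shuffle, are degeneracies of the top-dimensional simplices `u_σ` and `u_ρ`. -/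
theorem ofPerm_shufflePerm (α : Shuffle k l) (σ : Equiv.Perm (Fin k)) (ρ : Equiv.Perm (Fin l)) :
    ofPerm (shufflePerm α σ ρ) = pair ((ofPerm σ).comp (degenHom α.1 α.2).toOrderHom)
      ((ofPerm ρ).comp (degenHom α.1ᶜ α.card_compl).toOrderHom) := by
  ext t c
  refine Fin.addCases (fun c => ?_) (fun c => ?_) c
  · rw [pair_apply, Fin.append_left, ofPerm_apply, shufflePerm_symm_castAdd]
    exact decide_eq_decide.2 (lt_degenHom_iff _ _ _ _).symm
  · rw [pair_apply, Fin.append_right, ofPerm_apply, shufflePerm_symm_natAdd]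
    exact decide_eq_decide.2 (lt_degenHom_iff _ _ _ _).symm

theorem shufflePerm_lt_iff (α : Shuffle k l) (σ : Equiv.Perm (Fin k)) (ρ : Equiv.Perm (Fin l))
    (p : Fin (k + l)) : (shufflePerm α σ ρ p : ℕ) < k ↔ p ∈ α.1 := by
  obtain ⟨c, rfl⟩ := (shufflePerm α σ ρ).symm.surjective p
  rw [Equiv.apply_symm_apply]
  refine Fin.addCases (fun c => ?_) (fun c => ?_) c
  · rw [shufflePerm_symm_castAdd]
    exact iff_of_true c.2 (Finset.orderEmbOfFin_mem _ _ _)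
  · rw [shufflePerm_symm_natAdd]
    have := Finset.orderEmbOfFin_mem α.1ᶜ α.card_compl (ρ.symm c)
    rw [Finset.mem_compl] at this
    exact iff_of_false (by simp) this

theorem shufflePerm_bijective (k l : ℕ) : Function.Bijective
    fun c : Shuffle k l × Equiv.Perm (Fin k) × Equiv.Perm (Fin l) =>
      shufflePerm c.1 c.2.1 c.2.2 := by
  refine (Fintype.bijective_iff_injective_and_card _).2 ⟨?_, ?_⟩
  · rintro ⟨α, σ, ρ⟩ ⟨α', σ', ρ'⟩ h
    dsimp only at h
    obtain rfl : α = α' := Subtype.ext (Finset.ext fun p => by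
      rw [← shufflePerm_lt_iff α σ ρ, h, shufflePerm_lt_iff])
    have hσ : σ = σ' := Equiv.symm_bijective.injective (Equiv.ext fun c => by
      have := congrArg (fun π : Equiv.Perm (Fin (k + l)) => π.symm (Fin.castAdd l c)) h
      simpa only [shufflePerm_symm_castAdd, EmbeddingLike.apply_eq_iff_eq] using this)
    have hρ : ρ = ρ' := Equiv.symm_bijective.injective (Equiv.ext fun c => by
      have := congrArg (fun π : Equiv.Perm (Fin (k + l)) => π.symm (Fin.natAdd k c)) h
      simpa only [shufflePerm_symm_natAdd, EmbeddingLike.apply_eq_iff_eq] using this)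
    rw [hσ, hρ]
  · rw [Fintype.card_prod, Fintype.card_prod, Fintype.card_finset_len, Fintype.card_perm,
      Fintype.card_perm, Fintype.card_perm, Fintype.card_fin, Fintype.card_fin, Fintype.card_fin,
      ← mul_assoc]
    simpa using Nat.choose_mul_factorial_mul_factorial (Nat.le_add_right k l)

theorem sign_eq_neg_one_pow_inversions {n : ℕ} (π : Equiv.Perm (Fin n)) :
    ((Equiv.Perm.sign π : ℤˣ) : ℤ) =
      (-1) ^ ((Finset.univ.filter fun c : Fin n × Fin n => c.1 < c.2 ∧ π c.2 < π c.1).card) := by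
  rw [sign_eq_neg_one_pow_deg, SzIndex.deg]
  congr 1
  simp only [szIndexOfPerm_val]
  rw [← Finset.card_sigma]
  refine Finset.card_nbij' (fun c => (c.1, c.2)) (fun c => ⟨c.1, c.2⟩) ?_ ?_ ?_ ?_
  · rintro ⟨a, b⟩ h
    simpa using h
  · rintro ⟨a, b⟩ h
    simpa using h
  · rintro ⟨a, b⟩ _
    rfl
  · rintro ⟨a, b⟩ _
    rfl

/-- The inversions of the permutation listing first `α` and then its complement are the pairs
counted by the sign of the shuffle. -/
theorem Shuffle.sign_eq (α : Shuffle k l) :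
    α.sign = ((Equiv.Perm.sign (finSumFinEquiv.symm.trans
      (finSumEquivOfFinset α.2 α.card_compl)) : ℤˣ) : ℤ) := by
  set s : Equiv.Perm (Fin (k + l)) :=
    finSumFinEquiv.symm.trans (finSumEquivOfFinset α.2 α.card_compl) with hs
  have hl : ∀ c, s (Fin.castAdd l c) = α.1.orderEmbOfFin α.2 c := fun c => by simp [hs]
  have hr : ∀ c, s (Fin.natAdd k c) = α.1ᶜ.orderEmbOfFin α.card_compl c := fun c => by simp [hs]
  have hml : ∀ c, s (Fin.castAdd l c) ∈ α.1 := fun c => hl c ▸ Finset.orderEmbOfFin_mem _ _ _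
  have hmr : ∀ c, s (Fin.natAdd k c) ∉ α.1 := fun c =>
    Finset.mem_compl.1 (hr c ▸ Finset.orderEmbOfFin_mem _ _ _)
  rw [sign_eq_neg_one_pow_inversions, Shuffle.sign]
  congr 1
  symm
  refine Finset.card_bij (fun c _ => (s c.1, s c.2)) ?_ ?_ ?_
  · rintro ⟨i, j⟩ h
    simp only [Finset.mem_filter, Finset.mem_univ, true_and, Finset.mem_product,
      Finset.mem_compl] at h ⊢
    obtain ⟨hij, hs'⟩ := h
    refine ⟨?_, hs'⟩
    revert hij hs'
    refine Fin.addCases (fun i => ?_) (fun i => ?_) i <;>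
      refine Fin.addCases (fun j => ?_) (fun j => ?_) j <;> intro hij hs'
    · rw [hl, hl, OrderEmbedding.lt_iff_lt] at hs'
      exact absurd hs' (not_lt.2 hij.le)
    · exact ⟨hml i, hmr j⟩
    · exact absurd hij (by simp [Fin.lt_def]; omega)
    · rw [hr, hr, OrderEmbedding.lt_iff_lt] at hs'
      exact absurd hs' (by simpa using hij.le)
  · rintro ⟨i, j⟩ _ ⟨i', j'⟩ _ h
    simpa using h
  · rintro ⟨a, b⟩ h
    simp only [Finset.mem_filter, Finset.mem_product, Finset.mem_compl] at h
    obtain ⟨i, rfl⟩ := s.surjective a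
    obtain ⟨j, rfl⟩ := s.surjective b
    refine ⟨(i, j), ?_, rfl⟩
    simp only [Finset.mem_filter, Finset.mem_univ, true_and]
    refine ⟨?_, h.2⟩
    have h₁ := h.1.1
    have h₂ := h.1.2
    revert h₁ h₂
    refine Fin.addCases (fun i => ?_) (fun i => ?_) i <;>
      refine Fin.addCases (fun j => ?_) (fun j => ?_) j <;> intro h₁ h₂
    · exact absurd (hml j) h₂
    · simp [Fin.lt_def]; omega
    · exact absurd h₁ (hmr i)
    · exact absurd h₁ (hmr i)

theorem sign_shufflePerm (α : Shuffle k l) (σ : Equiv.Perm (Fin k)) (ρ : Equiv.Perm (Fin l)) :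
    ((Equiv.Perm.sign (shufflePerm α σ ρ) : ℤˣ) : ℤ) =
      (Equiv.Perm.sign σ : ℤˣ) * ((Equiv.Perm.sign ρ : ℤˣ) * α.sign) := by
  have e : shufflePerm α σ ρ = finSumFinEquiv.permCongr (Equiv.Perm.sumCongr σ ρ) *
      (finSumFinEquiv.symm.trans (finSumEquivOfFinset α.2 α.card_compl))⁻¹ := by
    ext p
    simp [shufflePerm, Equiv.permCongr_apply, Equiv.Perm.inv_def]
  rw [e, Equiv.Perm.sign_mul, Equiv.Perm.sign_permCongr, Equiv.Perm.sign_sumCongr,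
    Equiv.Perm.sign_inv, Shuffle.sign_eq]
  push_cast
  ring

end Shuffle

/-! ### Comparison with the Szczarba map -/

section Chains

open CubeSimplex

variable (R : Type v) [CommRing R]

/-- Multiplicative and unital linear maps are compatible with the maps `wordMap`. -/
theorem comp_wordMap {R M A B : Type*} [CommRing R] [AddCommGroup M] [Module R M] [AddCommGroup A]
    [Module R A] [AddCommGroup B] [Module R B] (μ : A →ₗ[R] A →ₗ[R] A) (e : A) (t : M →ₗ[R] A)
    (μ' : B →ₗ[R] B →ₗ[R] B) (φ : A →ₗ[R] B) (hφ : ∀ a b, φ (μ a b) = μ' (φ a) (φ b)) :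
    φ ∘ₗ wordMap μ e t = wordMap μ' (φ e) (φ ∘ₗ t) := by
  have key : ∀ (w : TensorAlgebra R M) (a : A),
      φ (TensorAlgebra.lift R (A := Module.End R A) (μ ∘ₗ t) w a) =
        TensorAlgebra.lift R (A := Module.End R B) (μ' ∘ₗ φ ∘ₗ t) w (φ a) := by
    intro w
    induction w using TensorAlgebra.induction with
    | algebraMap r => simp
    | ι m => simp [hφ]
    | mul w w' h h' => simp [h, h']
    | add w w' h h' => simp [h, h']
  ext w
  exact key w e

variable {G : SimplicialObject GrpCat.{u}}

section CubicalMonoid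

variable {Y : CubicalMonoid.{u}} (f : triangMonoid Y ⟶ G ⋙ forget₂ GrpCat MonCat)

/-- The image in `G` of a simplex of the triangulation. -/
abbrev triangApp {d : ℕ} (a : Triang Y.toCubicalSet d) : GSimp G d :=
  f.app (op (SimplexCategory.mk d)) a

theorem triangApp_mul {d : ℕ} (a b : Triang Y.toCubicalSet d) :
    triangApp f (a * b) = triangApp f a * triangApp f b :=
  map_mul (f.app (op (SimplexCategory.mk d))).hom a b

theorem triangApp_one (d : ℕ) : triangApp f (1 : Triang Y.toCubicalSet d) = 1 :=
  map_one (f.app (op (SimplexCategory.mk d))).hom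

theorem triangApp_map {d e : ℕ} (θ : SimplexCategory.mk e ⟶ SimplexCategory.mk d)
    (a : Triang Y.toCubicalSet d) :
    triangApp f (Triang.map θ.toOrderHom a) = G.map θ.op (triangApp f a) :=
  ConcreteCategory.congr_hom (f.naturality θ.op) a

theorem triangApp_shufflePerm {k l : ℕ} (y : Y.cube k) (z : Y.cube l) (α : Shuffle k l)
    (σ : Equiv.Perm (Fin k)) (ρ : Equiv.Perm (Fin l)) :
    triangApp f (Triang.mk (Y.mul y z) (ofPerm (shufflePerm α σ ρ))) =
      shuffleTerm α (triangApp f (Triang.mk y (ofPerm σ)))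
        (triangApp f (Triang.mk z (ofPerm ρ))) := by
  rw [ofPerm_shufflePerm, ← Triang.mk_mul_mk, triangApp_mul]
  unfold shuffleTerm
  rw [← triangApp_map, ← triangApp_map]
  rfl

theorem chainsMap_triangChains_of {n : ℕ} (y : Y.cube n) :
    chainsMap R (toSSetHom f) (triangChains R Y.toCubicalSet (NormChains.of R ⟨n, y⟩)) =
      ∑ π : Equiv.Perm (Fin n), ((Equiv.Perm.sign π : ℤˣ) : ℤ) •
        (NormChains.of R ⟨n, triangApp f (Triang.mk y (ofPerm π))⟩ : Chains R (toSSet G)) := by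
  rw [triangChains, NormChains.lift_of, map_sum]
  refine Finset.sum_congr rfl fun π _ => ?_
  rw [map_zsmul, chainsMap, NormChains.lift_of]
  rfl

/-- The composition `C(Y) → C(TY) → C(G)` is multiplicative, since each permutation of `k + l`
letters arises from a unique shuffle together with permutations of `k` and of `l` letters. -/
theorem chainsMap_triangChains_mul (a b : CubicalChains R Y.toCubicalSet) :
    chainsMap R (toSSetHom f) (triangChains R Y.toCubicalSet (cubicalMul R Y a b)) =
      shuffleMul R G (chainsMap R (toSSetHom f) (triangChains R Y.toCubicalSet a))
        (chainsMap R (toSSetHom f) (triangChains R Y.toCubicalSet b)) := by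
  let φ := chainsMap R (toSSetHom f) ∘ₗ triangChains R Y.toCubicalSet
  suffices h : (cubicalMul R Y).compr₂ φ = (shuffleMul R G).compl₁₂ φ φ from
    LinearMap.congr_fun (LinearMap.congr_fun h a) b
  refine NormChains.hom_ext fun s => NormChains.hom_ext fun s' => ?_
  obtain ⟨k, y⟩ := s
  obtain ⟨l, z⟩ := s'
  rw [LinearMap.compr₂_apply, LinearMap.compl₁₂_apply, cubicalMul, NormChains.lift₂_of]
  dsimp only [φ, LinearMap.comp_apply]
  rw [chainsMap_triangChains_of, chainsMap_triangChains_of, chainsMap_triangChains_of,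
    ← (shufflePerm_bijective k l).sum_comp, Fintype.sum_prod_type, Finset.sum_comm,
    Fintype.sum_prod_type,
    map_sum (shuffleMul R G), LinearMap.sum_apply]
  refine Finset.sum_congr rfl fun σ _ => ?_
  rw [map_sum]
  refine Finset.sum_congr rfl fun ρ _ => ?_
  rw [map_zsmul, map_zsmul, LinearMap.smul_apply, shuffleMul, NormChains.lift₂_of,
    Finset.smul_sum, Finset.smul_sum]
  refine Finset.sum_congr rfl fun α _ => ?_
  rw [sign_shufflePerm, triangApp_shufflePerm, mul_smul, mul_smul, smul_comm]

theorem chainsMap_triangChains_one :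
    chainsMap R (toSSetHom f) (triangChains R Y.toCubicalSet (NormChains.of R ⟨0, Y.one⟩)) =
      NormChains.of R ⟨0, (1 : GSimp G 0)⟩ := by
  rw [chainsMap_triangChains_of, Fintype.sum_unique]
  have e : Triang.mk Y.one (ofPerm default) = (1 : Triang Y.toCubicalSet 0) := by
    refine congrArg _ ?_
    ext t c
    exact c.elim0
  rw [e, triangApp_one]
  simp

end CubicalMonoid

variable {X : SSet.{u}} (τ : TwistingFunction X G)

theorem chainsMap_triangChains_cubeOf (hX : IsOneReduced X)
    {f : triangMonoid (cubicalCobar X) ⟶ G ⋙ forget₂ GrpCat MonCat}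
    (hf : ∀ (n : ℕ) (x : Simp X (n + 1)) (π : Equiv.Perm (Fin n)),
      f.app (op (SimplexCategory.mk n)) (Triang.mk (cobarCell x) (ofPerm π)) = τ.szPerm π x) :
    (chainsMap R (toSSetHom f) ∘ₗ triangChains R (cubicalCobar X).toCubicalSet) ∘ₗ cubeOf R X =
      szCochain R τ := by
  refine NormChains.hom_ext fun s => ?_
  obtain ⟨n, x⟩ := s
  rw [LinearMap.comp_apply, LinearMap.comp_apply, cubeOf, NormChains.lift_of, szCochain,
    NormChains.lift_of]
  dsimp only
  rcases n with _ | n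
  · -- In degree `0` both sides vanish: on the right, `Sz_∅ x = 1` since `x` is degenerate.
    obtain ⟨y⟩ := hX.nonempty_zero
    obtain rfl : X.σ 0 y = x := hX.subsingleton_one.elim _ _
    rw [if_pos rfl, if_pos rfl, map_zero, map_zero, Fintype.sum_unique, τ.sz_σ_zero]
    simp [SzIndex.deg]
  · rw [if_neg (Nat.succ_ne_zero n), if_neg (Nat.succ_ne_zero n), sub_zero,
      chainsMap_triangChains_of, ← (szIndexOfPerm_bijective (n + 1)).sum_comp]
    refine Finset.sum_congr rfl fun π _ => ?_
    rw [triangApp, hf, sign_eq_neg_one_pow_deg]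
    rfl

/-- A morphism of simplicial monoids with `f([⟨x⟩, u_π]) = Sz_π x` induces the Szczarba map. -/
theorem chainsMap_comp_cobarToCubical (hX : IsOneReduced X)
    {f : triangMonoid (cubicalCobar X) ⟶ G ⋙ forget₂ GrpCat MonCat}
    (hf : ∀ (n : ℕ) (x : Simp X (n + 1)) (π : Equiv.Perm (Fin n)),
      f.app (op (SimplexCategory.mk n)) (Triang.mk (cobarCell x) (ofPerm π)) = τ.szPerm π x) :
    chainsMap R (toSSetHom f) ∘ₗ triangChains R (cubicalCobar X).toCubicalSet ∘ₗ
      cobarToCubical R X = szMapCobar R τ := by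
  have h := comp_wordMap (cubicalMul R (cubicalCobar X))
    (NormChains.of R ⟨0, (cubicalCobar X).one⟩) (cubeOf R X) (shuffleMul R G)
    (chainsMap R (toSSetHom f) ∘ₗ triangChains R (cubicalCobar X).toCubicalSet)
    (chainsMap_triangChains_mul R f)
  rw [chainsMap_triangChains_cubeOf R τ hX hf, LinearMap.comp_apply,
    chainsMap_triangChains_one] at h
  exact h

end Chains

end SzCobar

theorem theorem1p1 {X : SSet.{u}} (hX : IsOneReduced X) (G : SimplicialObject GrpCat.{u})
    (τ : TwistingFunction X G) :
    ∃ f : triangMonoid (cubicalCobar X) ⟶ G ⋙ forget₂ GrpCat MonCat,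
      (∀ (n : ℕ) (x : Simp X (n + 1)) (π : Equiv.Perm (Fin n)),
        f.app (op (SimplexCategory.mk n)) (Triang.mk (cobarCell x) (CubeSimplex.ofPerm π)) =
          τ.szPerm π x) ∧
      (∀ g : triangMonoid (cubicalCobar X) ⟶ G ⋙ forget₂ GrpCat MonCat,
        (∀ (n : ℕ) (x : Simp X (n + 1)) (π : Equiv.Perm (Fin n)),
          g.app (op (SimplexCategory.mk n)) (Triang.mk (cobarCell x) (CubeSimplex.ofPerm π)) =
            τ.szPerm π x) → g = f) ∧
      ∀ (R : Type v) [CommRing R],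
        chainsMap R (toSSetHom f) ∘ₗ triangChains R (cubicalCobar X).toCubicalSet ∘ₗ
          cobarToCubical R X = szMapCobar R τ := by
  have hf : ∀ (n : ℕ) (x : Simp X (n + 1)) (π : Equiv.Perm (Fin n)),
      (szMorphism τ hX).app (op (SimplexCategory.mk n))
        (Triang.mk (cobarCell x) (CubeSimplex.ofPerm π)) = τ.szPerm π x := fun n x π =>
    (szMorphism_cobarCell τ hX x _).trans (cellValue_ofPerm τ x π)
  exact ⟨szMorphism τ hX, hf, fun g hg => triangMonoid_hom_ext fun n x π =>
    (hg n x π).trans (hf n x π).symm, fun R _ => chainsMap_comp_cobarToCubical R τ hX hf⟩
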